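/- **Setting.** Polynomial time means polynomial-size families $(C_n)_n$ of probabilistic Boolean circuits with oracle gates, one circuit for each word size $n$. A function of $n$ is negligible if it tends to $0$ faster than every inverse polynomial. *Encryption.* Fix $w$. For each $n$ let $\mathcal E$ be a (randomized) correct secret-key encryption, with ciphertexts of length polynomial in $n$, of plaintexts consisting of $w$ bits of hidden padding and an $n$-bit word. *Platform.* The processor has a set of primitive binary operations $\theta$ and binary tests $R$ on $n$-bit words, each computed by circuits of size polynomial in $n$. Its instructions are $r_0\leftarrow (r_1-k_1)\,\theta\,(r_2-k_2)+k_0$, copy $r_0\leftarrow r_1$, jump, and "branch if $(r_1-k_1)\,R\,(r_2-k_2)$", with arithmetic mod $2^n$. Locations (registers and memory) hold encrypted words and the constants $k_i$ are embedded encrypted; the processor takes encrypted inputs to freshly encrypted outputs. The padding distinguishes runtime data from constants, and constants of different opcodes or positions; an instruction given a word of the wrong kind yields random nonsense (a uniformly random word or bit). *Chaotic compilation.* A nominal program has finitely many locations and instructions $r_0\leftarrow (r_1\,\theta\,r_2)+v$, copy, jump, and "branch if $r_1\,R\,r_2$". An obfuscation scheme $D$ assigns an $n$-bit offset to each location at each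 program point, such that along each control-flow edge the offset of every location that is not written is unchanged and a copy preserves the data exactly (so offsets agree where control paths join). The compiler picks $D$ uniformly at random among all these schemes and sets the constants and the input data so that every content is offset from its nominal value as $D$ says: $k_1,k_2$ are the offsets of $r_1,r_2$ before the instruction, and $k_0$ is $v$ plus the offset of $r_0$ after it. *Game.* For each $n$ the operator selects a nominal program $P_n$ (of any length; for example one program unrolled, with its branches bundled, to any super-polynomial length) and input data $d_n$. The user compiles them chaotically and encrypts the compiled code's constants and the data. The operator knows $P_n$ and $d_n$ but neither the key nor $D$. It sees the encrypted content of polynomially many initial locations and code addresses of its choice and may have the platform execute any instruction with any opcode on encrypted constants and operands that it supplies, seeing the encrypted result or the branch decision, as often as polynomial time allows. It is *restricted* if words other than ciphertexts that it has been shown are always treated as being of the wrong kind, and *unrestricted* if it may supply arbitrary words, which the platform decrypts. **Claim.** If $\mathcal E$ is IND-CPA secure (left-or-right) against polynomial time, then for every restricted polynomial-time operator: 1. for every location $r_n$ and time $t_n$ in the run of the compiled $P_n$ on the compiled $d_n$, and every attribute $\varphi_n$ of $n$-bit words (for example the whole word), the probability that the operator's output is $\varphi_n(x)$, where $x$ is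 the plaintext beneath the encryption in $r_n$ after $t_n$ steps, exceeds chance $\max_y |\{x:\varphi_n(x)=\varphi_n(y)\}|/2^n$ by at most a negligible amount; 2. the probability that the operator outputs an encrypted data word (in the restricted case, one that it has been shown) together with the plaintext beneath it exceeds $2^{-n}$ by at most a negligible amount. If moreover $\mathcal E$ has ciphertext integrity (INT-CTXT: no polynomial-time forger with an encryption oracle produces, with non-negligible probability, a valid ciphertext that it was not issued), then 1 and 2 hold for every unrestricted polynomial-time operator. -/

import Mathlib

/-- A natural-number valued quantity is polynomially bounded in the word size `n`. -/
def PolyBounded (f : ℕ → ℕ) : Prop :=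
  ∃ p : Polynomial ℕ, ∀ n, f n ≤ p.eval n

/-- `ε` tends to zero faster than the inverse of every polynomial. -/
def Negligible (ε : ℕ → ℝ) : Prop :=
  Asymptotics.SuperpolynomialDecay Filter.atTop (fun n : ℕ => (n : ℝ)) ε

/-- The probability of the event `S` under `p`, as a real number. -/
noncomputable def prob {α : Type} (p : PMF α) (S : Set α) : ℝ :=
  (p.toOuterMeasure S).toReal

/-! ### Bit strings -/

/-- The bits of a word, least significant first. -/
def wordBits {n : ℕ} (x : BitVec n) : List Bool :=
  List.ofFn fun i : Fin n => x.getLsb i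

/-- The `n`-bit word that starts at position `off` of a bit string (missing bits are `false`). -/
def readWord (n off : ℕ) (s : List Bool) : BitVec n :=
  BitVec.ofFnLE fun i : Fin n => s.getD (off + i) false

/-! ### Circuits

Polynomial time is measured by polynomial-size families of circuits, one circuit for each word
size.  A circuit is a list of gates; each gate appends its output bits to the list of wires, and
a wire that is not there carries `false`. -/

/-- The value of wire `i`. -/
def wire (ws : List Bool) (i : ℕ) : Bool := ws.getD i false

/-- A circuit of NAND gates, used for the arithmetic units of the processor.  Gate `(i, j)` appends
the NAND of wires `i` and `j`; `out` lists the output wires. -/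
structure LogicCircuit where
  gates : List (ℕ × ℕ)
  out : List ℕ

/-- Number of gates and of output pins. -/
def LogicCircuit.size (C : LogicCircuit) : ℕ := C.gates.length + C.out.length

/-- The output bits of a logic circuit on given input bits. -/
def LogicCircuit.eval (C : LogicCircuit) (input : List Bool) : List Bool :=
  C.out.map (wire (C.gates.foldl (fun ws g => ws ++ [!(wire ws g.1 && wire ws g.2)]) input))

/-- A family of two-operand functions on `n`-bit words is computed by polynomial-size circuits. -/
def PolySizeComputable (f : ∀ n : ℕ, BitVec n → BitVec n → List Bool) : Prop :=
  ∃ C : ℕ → LogicCircuit, PolyBounded (fun n => (C n).size) ∧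
    ∀ n (x y : BitVec n), (C n).eval (wordBits x ++ wordBits y) = f n x y

/-- The gates of a probabilistic circuit with access to oracles indexed by `κ`. -/
inductive Gate (κ : Type) : Type
  | nand (i j : ℕ)
  | coin
  | ask (k : κ) (query : List ℕ)

/-- The cost of a gate: one step, plus one for each wire sent to an oracle. -/
def Gate.cost {κ : Type} : Gate κ → ℕ
  | .nand _ _ => 1
  | .coin => 1
  | .ask _ q => 1 + q.length

/-- A probabilistic oracle circuit with its list of output wires. -/
structure OracleCircuit (κ : Type) where
  gates : List (Gate κ)
  out : List ℕ

/-- The size of an oracle circuit: the total cost of its gates plus the number of output wires. -/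
def OracleCircuit.size {κ : Type} (C : OracleCircuit κ) : ℕ :=
  (C.gates.map Gate.cost).sum + C.out.length

/-- Runs the gates one after the other.  `O k q s` is the distribution of the reply of oracle `k`
to the query `q` in state `s`, together with its next state. -/
noncomputable def runGates {κ σ : Type} (O : κ → List Bool → σ → PMF (List Bool × σ)) :
    List (Gate κ) → List Bool → σ → PMF (List Bool × σ)
  | [], ws, s => PMF.pure (ws, s)
  | .nand i j :: gs, ws, s => runGates O gs (ws ++ [!(wire ws i && wire ws j)]) s
  | .coin :: gs, ws, s =>
      (PMF.uniformOfFintype Bool).bind fun b => runGates O gs (ws ++ [b]) s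
  | .ask k q :: gs, ws, s =>
      (O k (q.map (wire ws)) s).bind fun r => runGates O gs (ws ++ r.1) r.2

/-- The output bits and the final oracle state of an oracle circuit on given input bits. -/
noncomputable def OracleCircuit.run {κ σ : Type} (C : OracleCircuit κ)
    (O : κ → List Bool → σ → PMF (List Bool × σ)) (input : List Bool) (s : σ) :
    PMF (List Bool × σ) :=
  (runGates O C.gates input s).map fun r => (C.out.map (wire r.1), r.2)

/-! ### Encryption -/

/-- A secret-key encryption, for every `n`, of an `n`-bit word together with `w` bits of hidden
padding.  A plaintext is a pair (padding, word); `enc` may be randomized, so that a plaintext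
has many aliases; `dec` rejects by returning `none`. -/
structure Encryption (w : ℕ) where
  Key : ℕ → Type
  ctLen : ℕ → ℕ
  gen : ∀ n, PMF (Key n)
  enc : ∀ n, Key n → BitVec w × BitVec n → PMF (BitVec (ctLen n))
  dec : ∀ n, Key n → BitVec (ctLen n) → Option (BitVec w × BitVec n)
  correct : ∀ n k m c, k ∈ (gen n).support → c ∈ (enc n k m).support → dec n k c = some m
  ctLen_poly : PolyBounded ctLen

namespace Encryption

variable {w : ℕ} (E : Encryption w)

/-- The plaintext (padding, word) that starts at position `off` of a bit string. -/
def readPlain (w n off : ℕ) (s : List Bool) : BitVec w × BitVec n :=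
  (readWord w off s, readWord n (off + w) s)

/-- The left-or-right oracle: of the two plaintexts in the query, it encrypts the first if
`b` is `false` and the second if `b` is `true`. -/
noncomputable def leftRight (n : ℕ) (k : E.Key n) (b : Bool) :
    Unit → List Bool → Unit → PMF (List Bool × Unit) := fun _ q _ =>
  (E.enc n k (if b then readPlain w n (w + n) q else readPlain w n 0 q)).map fun c =>
    (wordBits c, ())

/-- The probability that a distinguisher answers `1` when facing the left-or-right oracle. -/
noncomputable def acceptProb (n : ℕ) (C : OracleCircuit Unit) (b : Bool) : ℝ :=
  prob ((E.gen n).bind fun k => C.run (E.leftRight n k b) [] ()) {r | r.1 = [true]}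

/-- Ciphertext indistinguishability under chosen-plaintext attack (IND-CPA) against
polynomial-size circuits. -/
def INDCPA : Prop :=
  ∀ C : ℕ → OracleCircuit Unit, PolyBounded (fun n => (C n).size) →
    Negligible fun n => |E.acceptProb n (C n) true - E.acceptProb n (C n) false|

/-- The encryption oracle, which records the ciphertexts it has issued. -/
noncomputable def encOracle (n : ℕ) (k : E.Key n) :
    Unit → List Bool → List (BitVec (E.ctLen n)) →
      PMF (List Bool × List (BitVec (E.ctLen n))) := fun _ q issued =>
  (E.enc n k (readPlain w n 0 q)).map fun c => (wordBits c, c :: issued)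

/-- The probability that, under chosen-plaintext attack, a forger outputs a valid ciphertext that
was not issued to it. -/
noncomputable def forgeProb (n : ℕ) (C : OracleCircuit Unit) : ℝ :=
  prob ((E.gen n).bind fun k =>
      (C.run (E.encOracle n k) [] []).map fun r => (k, readWord (E.ctLen n) 0 r.1, r.2))
    {r | r.2.1 ∉ r.2.2 ∧ (E.dec n r.1 r.2.1).isSome}

/-- Integrity of ciphertexts (INT-CTXT) against polynomial-size circuits. -/
def INTCTXT : Prop :=
  ∀ C : ℕ → OracleCircuit Unit, PolyBounded (fun n => (C n).size) →
    Negligible fun n => E.forgeProb n (C n)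

end Encryption

/-! ### The instruction set -/

/-- What an encrypted word is meant to be: runtime data, or the embedded constant in a given
position of an instruction with a given opcode. -/
inductive WordKind (Op Rel : Type) : Type
  | data
  | opConst (θ : Op) (j : Fin 3)
  | relConst (R : Rel) (j : Fin 2)

/-- The primitive operations and tests of the processor, for every word size.  The injective `tag`
is the hidden padding that excludes collisions between runtime data and constants, and between
constants of different opcodes or positions. -/
structure InstructionSet (w : ℕ) where
  Op : Type
  Rel : Type
  eval : Op → ∀ n, BitVec n → BitVec n → BitVec n
  test : Rel → ∀ n, BitVec n → BitVec n → Bool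
  eval_poly : ∀ θ, PolySizeComputable fun n x y => wordBits (eval θ n x y)
  test_poly : ∀ R, PolySizeComputable fun n x y => [test R n x y]
  tag : WordKind Op Rel → BitVec w
  tag_injective : Function.Injective tag

variable {w : ℕ}

/-- Nominal machine code, for `L` locations (registers and memory) and `m` instructions.
Program point `m` is the end of the program. -/
inductive Instr (I : InstructionSet w) (n L m : ℕ) : Type
  /-- `r₀ ← (r₁ θ r₂) + v` -/
  | op (θ : I.Op) (r₀ r₁ r₂ : Fin L) (v : BitVec n)
  /-- `r₀ ← r₁` -/
  | move (r₀ r₁ : Fin L)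
  /-- if `r₁ R r₂` then go to `j` -/
  | branch (R : I.Rel) (r₁ r₂ : Fin L) (j : Fin (m + 1))
  /-- go to `j` -/
  | jump (j : Fin (m + 1))

/-- Machine code for encrypted computing, here with the embedded constants in plaintext. -/
inductive ObjInstr (I : InstructionSet w) (n L m : ℕ) : Type
  /-- `r₀ ← ((r₁ - k₁) θ (r₂ - k₂)) + k₀` -/
  | op (θ : I.Op) (r₀ r₁ r₂ : Fin L) (k₀ k₁ k₂ : BitVec n)
  /-- `r₀ ← r₁` -/
  | move (r₀ r₁ : Fin L)
  /-- if `(r₁ - k₁) R (r₂ - k₂)` then go to `j` -/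
  | branch (R : I.Rel) (r₁ r₂ : Fin L) (j : Fin (m + 1)) (k₁ k₂ : BitVec n)
  /-- go to `j` -/
  | jump (j : Fin (m + 1))

/-- The state of the processor: the program point and the content of the locations. -/
structure Config (n L m : ℕ) where
  pc : Fin (m + 1)
  store : Fin L → BitVec n

/-- One step of a nominal instruction at program point `a`. -/
def Instr.step {I : InstructionSet w} {n L m : ℕ} (a : Fin m) (s : Fin L → BitVec n) :
    Instr I n L m → Config n L m
  | .op θ r₀ r₁ r₂ v => ⟨a.succ, Function.update s r₀ (I.eval θ n (s r₁) (s r₂) + v)⟩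
  | .move r₀ r₁ => ⟨a.succ, Function.update s r₀ (s r₁)⟩
  | .branch R r₁ r₂ j => ⟨if I.test R n (s r₁) (s r₂) then j else a.succ, s⟩
  | .jump j => ⟨j, s⟩

/-- One step, beneath the encryption, of an instruction with embedded constants. -/
def ObjInstr.step {I : InstructionSet w} {n L m : ℕ} (a : Fin m) (s : Fin L → BitVec n) :
    ObjInstr I n L m → Config n L m
  | .op θ r₀ r₁ r₂ k₀ k₁ k₂ =>
      ⟨a.succ, Function.update s r₀ (I.eval θ n (s r₁ - k₁) (s r₂ - k₂) + k₀)⟩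
  | .move r₀ r₁ => ⟨a.succ, Function.update s r₀ (s r₁)⟩
  | .branch R r₁ r₂ j k₁ k₂ =>
      ⟨if I.test R n (s r₁ - k₁) (s r₂ - k₂) then j else a.succ, s⟩
  | .jump j => ⟨j, s⟩

/-- The embedded constants of an instruction as plaintexts, with their tags. -/
def ObjInstr.constants {I : InstructionSet w} {n L m : ℕ} :
    ObjInstr I n L m → List (BitVec w × BitVec n)
  | .op θ _ _ _ k₀ k₁ k₂ =>
      [(I.tag (.opConst θ 0), k₀), (I.tag (.opConst θ 1), k₁), (I.tag (.opConst θ 2), k₂)]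
  | .branch R _ _ _ k₁ k₂ => [(I.tag (.relConst R 0), k₁), (I.tag (.relConst R 1), k₂)]
  | _ => []

/-- A nominal machine code program for `n`-bit words. -/
structure Program (I : InstructionSet w) (n : ℕ) where
  locs : ℕ
  len : ℕ
  code : Fin len → Instr I n locs len

namespace Program

variable {I : InstructionSet w} {n : ℕ} (P : Program I n)

/-- The nominal configuration after `t` steps on input data `d`. -/
def nominalRun (d : Fin P.locs → BitVec n) : ℕ → Config n P.locs P.len
  | 0 => ⟨0, d⟩
  | t + 1 =>
      let c := nominalRun d t
      if h : c.pc.val < P.len then (P.code ⟨c.pc, h⟩).step ⟨c.pc, h⟩ c.store else c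

/-- An obfuscation scheme: an offset from nominal for every location at every program point. -/
abbrev Scheme := Fin (P.len + 1) → Fin P.locs → BitVec n

/-- The condition that an instruction at `a` imposes on an obfuscation scheme: the offsets at `a`
and at each next point agree in every location that is not written, a copy preserves data
exactly, and the offset of the result of an arithmetic instruction is free. -/
def Respects (D : P.Scheme) (a : Fin P.len) : Prop :=
  match P.code a with
  | .op _ r₀ _ _ _ => ∀ l, l ≠ r₀ → D a.succ l = D a.castSucc l
  | .move r₀ r₁ =>
      D a.succ r₀ = D a.castSucc r₁ ∧ ∀ l, l ≠ r₀ → D a.succ l = D a.castSucc l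
  | .branch _ _ _ j => D a.succ = D a.castSucc ∧ D j = D a.castSucc
  | .jump j => D j = D a.castSucc

/-- A scheme that every instruction respects; so offsets agree where control paths join. -/
def Consistent (D : P.Scheme) : Prop := ∀ a, P.Respects D a

theorem consistent_zero : P.Consistent 0 := by
  intro a
  unfold Respects
  split <;> simp

instance : Nonempty {D : P.Scheme // P.Consistent D} := ⟨⟨0, P.consistent_zero⟩⟩

open scoped Classical in
/-- The compiler's choice: all consistent obfuscation schemes are equally probable. -/
noncomputable def randomScheme : PMF {D : P.Scheme // P.Consistent D} :=
  PMF.uniformOfFintype _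

/-- The chaotically compiled code: the constants implement the obfuscation scheme. -/
def compile (D : P.Scheme) (a : Fin P.len) : ObjInstr I n P.locs P.len :=
  match P.code a with
  | .op θ r₀ r₁ r₂ v =>
      .op θ r₀ r₁ r₂ (v + D a.succ r₀) (D a.castSucc r₁) (D a.castSucc r₂)
  | .move r₀ r₁ => .move r₀ r₁
  | .branch R r₁ r₂ j => .branch R r₁ r₂ j (D a.castSucc r₁) (D a.castSucc r₂)
  | .jump j => .jump j

/-- The input data as encoded for the compiled code. -/
def compileInput (D : P.Scheme) (d : Fin P.locs → BitVec n) : Fin P.locs → BitVec n :=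
  d + D 0

/-- The configuration, beneath the encryption, of the compiled code on the compiled input data
after `t` steps. -/
def compiledRun (D : P.Scheme) (d : Fin P.locs → BitVec n) : ℕ → Config n P.locs P.len
  | 0 => ⟨0, P.compileInput D d⟩
  | t + 1 =>
      let c := compiledRun D d t
      if h : c.pc.val < P.len then (P.compile D ⟨c.pc, h⟩).step ⟨c.pc, h⟩ c.store else c

/-- The compiled code follows the nominal control flow, with every content offset from nominal as
the scheme says. -/
theorem compiledRun_eq {D : P.Scheme} (hD : P.Consistent D) (d : Fin P.locs → BitVec n) (t : ℕ) :
    P.compiledRun D d t =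
      ⟨(P.nominalRun d t).pc, (P.nominalRun d t).store + D (P.nominalRun d t).pc⟩ := by
  induction t with
  | zero => rfl
  | succ t ih =>
    rw [compiledRun, nominalRun, ih]
    generalize P.nominalRun d t = c
    obtain ⟨pc, s⟩ := c
    by_cases h : pc.val < P.len
    · have hc := hD ⟨pc, h⟩
      simp only [h, dif_pos]
      unfold Respects at hc
      unfold compile
      have e : (⟨pc.val, h⟩ : Fin P.len).castSucc = pc := rfl
      rw [e] at hc ⊢
      cases hi : P.code ⟨pc, h⟩ with
      | op θ r₀ r₁ r₂ v =>
        rw [hi] at hc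
        simp only [Fin.succ_mk] at hc
        simp only [Instr.step, ObjInstr.step, Config.mk.injEq, true_and]
        funext l
        by_cases hl : l = r₀
        · subst hl; simp [add_assoc]
        · simp [hl, hc l hl]
      | move r₀ r₁ =>
        rw [hi] at hc
        simp only [Fin.succ_mk] at hc
        simp only [Instr.step, ObjInstr.step, Config.mk.injEq, true_and]
        funext l
        by_cases hl : l = r₀
        · subst hl; simp [hc.1]
        · simp [hl, hc.2 l hl]
      | branch R r₁ r₂ j =>
        rw [hi] at hc
        simp only [Fin.succ_mk] at hc
        simp only [Instr.step, ObjInstr.step, Pi.add_apply, add_sub_cancel_right]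
        split <;> simp [hc.1, hc.2]
      | jump j =>
        rw [hi] at hc
        simp only at hc
        simp [Instr.step, ObjInstr.step, hc]
    · simp [h]

/-- The plaintexts that the operator meets, encrypted, on looking at the initial content of a
location or at the code at an address. -/
def itemPlains (D : P.Scheme) (d : Fin P.locs → BitVec n) :
    Fin P.locs ⊕ Fin P.len → List (BitVec w × BitVec n)
  | .inl l => [(I.tag .data, P.compileInput D d l)]
  | .inr a => (P.compile D a).constants

end Program

/-! ### The platform and the operator -/

/-- How the operator may interfere: with words that it has observed (copied, moved, transplanted
or substituted for one another), or with arbitrary words of its own making. -/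
inductive Interference : Type
  | observed
  | arbitrary

section Platform

variable (E : Encryption w) (I : InstructionSet w) (n : ℕ) (k : E.Key n)

open scoped Classical in
/-- The plaintext that the platform finds beneath a word supplied by the operator. -/
noncomputable def plainOf (μ : Interference) (issued : List (BitVec (E.ctLen n)))
    (c : BitVec (E.ctLen n)) : Option (BitVec w × BitVec n) :=
  match μ with
  | .observed => if c ∈ issued then E.dec n k c else none
  | .arbitrary => E.dec n k c

open scoped Classical in
/-- The content of a supplied word, if the platform finds it to be of the right kind. -/
noncomputable def contentOf (μ : Interference) (issued : List (BitVec (E.ctLen n)))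
    (κ : WordKind I.Op I.Rel) (c : BitVec (E.ctLen n)) : Option (BitVec n) :=
  (plainOf E n k μ issued c).bind fun m => if m.1 = I.tag κ then some m.2 else none

/-- The platform executes single instructions for the operator, who supplies the opcode, the
encrypted constants and the encrypted operands, in this order.  An arithmetic instruction returns
an encrypted result, a test returns the bit that decides the branch.  If a supplied word is not of
the right kind, the result is random nonsense.  The state is the list of ciphertexts that the
operator has been shown. -/
noncomputable def platform (μ : Interference) :
    I.Op ⊕ I.Rel → List Bool → List (BitVec (E.ctLen n)) →
      PMF (List Bool × List (BitVec (E.ctLen n)))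
  | .inl θ, q, issued =>
      let x (κ : WordKind I.Op I.Rel) (i : ℕ) : Option (BitVec n) :=
        contentOf E I n k μ issued κ (readWord (E.ctLen n) (i * E.ctLen n) q)
      let result : PMF (BitVec n) :=
        match x (.opConst θ 0) 0, x (.opConst θ 1) 1, x (.opConst θ 2) 2, x .data 3, x .data 4 with
        | some k₀, some k₁, some k₂, some x₁, some x₂ =>
            PMF.pure (I.eval θ n (x₁ - k₁) (x₂ - k₂) + k₀)
        | _, _, _, _, _ => PMF.uniformOfFintype (BitVec n)
      result.bind fun y =>
        (E.enc n k (I.tag .data, y)).map fun c => (wordBits c, c :: issued)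
  | .inr R, q, issued =>
      let x (κ : WordKind I.Op I.Rel) (i : ℕ) : Option (BitVec n) :=
        contentOf E I n k μ issued κ (readWord (E.ctLen n) (i * E.ctLen n) q)
      let result : PMF Bool :=
        match x (.relConst R 0) 0, x (.relConst R 1) 1, x .data 2, x .data 3 with
        | some k₁, some k₂, some x₁, some x₂ => PMF.pure (I.test R n (x₁ - k₁) (x₂ - k₂))
        | _, _, _, _ => PMF.uniformOfFintype Bool
      result.map fun b => ([b], issued)

/-- Encrypts a list of plaintexts, each with fresh randomness. -/
noncomputable def encryptAll : List (BitVec w × BitVec n) → PMF (List (BitVec (E.ctLen n)))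
  | [] => PMF.pure []
  | m :: ms => (E.enc n k m).bind fun c => (encryptAll ms).map fun cs => c :: cs

end Platform

/-- An operator.  For each word size it fixes the nominal program and input data, the locations
and code addresses at which it looks, and the circuit that, from the ciphertexts found there and by
experiments on the platform, computes its output. -/
structure Operator (I : InstructionSet w) where
  prog : ∀ n, Program I n
  input : ∀ n, Fin (prog n).locs → BitVec n
  view : ∀ n, List (Fin (prog n).locs ⊕ Fin (prog n).len)
  circuit : ℕ → OracleCircuit (I.Op ⊕ I.Rel)

namespace Operator

variable {I : InstructionSet w} (A : Operator I) (E : Encryption w)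

/-- The operator works in time polynomial in the word size.  The program itself may be longer. -/
def PolyTime : Prop :=
  PolyBounded (fun n => (A.view n).length) ∧ PolyBounded (fun n => (A.circuit n).size)

/-- What there is at the end of the game. -/
structure Outcome (n : ℕ) where
  key : E.Key n
  scheme : (A.prog n).Scheme
  output : List Bool
  issued : List (BitVec (E.ctLen n))

/-- The game: a key is drawn, the program and the data are chaotically compiled and encrypted, and
the operator examines, runs and interferes with the encrypted code and data. -/
noncomputable def game (μ : Interference) (n : ℕ) : PMF (A.Outcome E n) :=
  (E.gen n).bind fun k =>
    (A.prog n).randomScheme.bind fun D =>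
      (encryptAll E n k ((A.view n).flatMap ((A.prog n).itemPlains D.1 (A.input n)))).bind fun cs =>
        ((A.circuit n).run (platform E I n k μ) (cs.flatMap wordBits) cs).map fun r =>
          ⟨k, D.1, r.1, r.2⟩

/-- The operator's output is the attribute `φ` of the plaintext value beneath the encryption in
location `r` after `t` steps of the compiled program. -/
def discovers {n : ℕ} (t : ℕ) (r : Fin (A.prog n).locs) (φ : BitVec n → List Bool) :
    Set (A.Outcome E n) :=
  {o | o.output = φ (((A.prog n).compiledRun o.scheme (A.input n) t).store r)}

/-- The operator's output is an encrypted data word followed by the plaintext value beneath it. -/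
def alters (μ : Interference) {n : ℕ} : Set (A.Outcome E n) :=
  {o | contentOf E I n o.key μ o.issued .data (readWord (E.ctLen n) 0 o.output) =
    some (readWord n (E.ctLen n) o.output)}

end Operator

/-- The best chance of being right about the attribute `φ` of a uniformly random `n`-bit word
without any information: the largest proportion of words that share an attribute. -/
noncomputable def chance {n : ℕ} (φ : BitVec n → List Bool) : ℝ :=
  ((Finset.univ.sup fun y : BitVec n => (Finset.univ.filter fun x => φ x = φ y).card : ℕ) : ℝ)
    / 2 ^ n

/-- Encrypted computing resists polynomial-time attacks on the runtime data: no polynomial-time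
operator discovers the plaintext value at a point in the trace, or an attribute of it, nor exhibits
an encrypted data word with known plaintext, with probability non-negligibly above chance. -/
def ResistsAttacks (E : Encryption w) (I : InstructionSet w) (μ : Interference) : Prop :=
  ∀ A : Operator I, A.PolyTime →
    (∀ (t : ℕ → ℕ) (r : ∀ n, Fin (A.prog n).locs) (φ : ∀ n, BitVec n → List Bool),
      ∃ ε : ℕ → ℝ, Negligible ε ∧
        ∀ n, prob (A.game E μ n) (A.discovers E (t n) (r n) (φ n)) ≤ chance (φ n) + ε n) ∧
    (∃ ε : ℕ → ℝ, Negligible ε ∧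
      ∀ n, prob (A.game E μ n) (A.alters E μ) ≤ 1 / 2 ^ n + ε n)

/-! ### NAND circuits -/

/-! The proof rests on a symmetry of chaotic compilation. Every constraint on an obfuscation scheme
equates two offsets, so adding one word `δ` to all offsets at all program points maps consistent
schemes bijectively to consistent schemes. A uniform scheme may therefore be replaced by a scheme
`D` shifted by an independent uniform `δ` (`Program.randomScheme_bind_shift`). The shift adds `δ` to
every embedded constant, every datum and every content in the trace, and leaves the tags and the
control flow alone (`itemPlains_shift`, `compiledRun_shift`). The processor respects it too: `δ`
cancels in `r - k`, the constant `k₀` restores it in the result, and tests do not see it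
(`platform_observed`).

A restricted operator supplies only words it has been shown, so the platform can be run without
decryption, from a table recording the unshifted plaintext of each issued ciphertext. A circuit with
a left-or-right oracle can do this, asking for an encryption of `m` or of `m` shifted by `δ`
(`exists_reduction`). One side of the oracle reproduces the real game. On the other, the transcript
does not depend on `δ`, so `δ` may be drawn after the operator has answered, and success is bounded
by counting offsets (`uniform_attribute_le`, `uniform_shift_le`). IND-CPA makes the two sides
negligibly different (`exists_negligible_observed`). Circuits are nonuniform, so the worst `D` and
`δ` for each word size can be hardwired. Only the plaintexts of the items in view enter the circuit,
which is why the length of the program is irrelevant.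

An unrestricted operator meets the same platform until it submits a valid ciphertext that was not
issued (`runGates_until_bad`). Stopping the restricted run just before such a query and outputting
the offending word is a forgery, and the restricted run needs only an encryption oracle
(`exists_forger`). A union bound over the gates and the five word positions, with INT-CTXT, reduces
the unrestricted case to the restricted one.

Most of the work is the explicit polynomial bound on the size of the simulating circuits. -/

theorem wire_append_left {ws : List Bool} {i : ℕ} (h : i < ws.length) (z : List Bool) :
    wire (ws ++ z) i = wire ws i := by
  simp [wire, List.getElem?_append, h]

theorem wire_append_right (ws z : List Bool) (i : ℕ) :
    wire (ws ++ z) (ws.length + i) = wire z i := by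
  simp [wire, List.getElem?_append]

theorem wire_eq_false {ws : List Bool} {i : ℕ} (h : ws.length ≤ i) : wire ws i = false := by
  simp [wire, h]

/-- The bound on the indices matters: a missing wire carries `false`, and appending bits could give
it another value. For this reason the output wires of the circuits below are always required to
exist. -/
theorem map_wire_append {ws : List Bool} {L : List ℕ} (h : ∀ i ∈ L, i < ws.length)
    (z : List Bool) : L.map (wire (ws ++ z)) = L.map (wire ws) :=
  List.map_congr_left fun i hi => wire_append_left (h i hi) z

theorem map_wire_range (ws : List Bool) : (List.range ws.length).map (wire ws) = ws := by
  apply List.ext_getElem <;> simp +contextual [wire]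

theorem map_wire_range' (ws z : List Bool) :
    (List.range' ws.length z.length).map (wire (ws ++ z)) = z := by
  apply List.ext_getElem
  · simp
  · intro i h1 h2
    simp only [List.getElem_map, List.getElem_range', one_mul, wire_append_right]
    simp [wire, h2]

/-- Runs NAND gates one after the other. -/
def nandRun (gs : List (ℕ × ℕ)) (ws : List Bool) : List Bool :=
  gs.foldl (fun ws g => ws ++ [!(wire ws g.1 && wire ws g.2)]) ws

theorem nandRun_append (gs hs : List (ℕ × ℕ)) (ws : List Bool) :
    nandRun (gs ++ hs) ws = nandRun hs (nandRun gs ws) := by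
  simp [nandRun]

theorem nandRun_eq_append (gs : List (ℕ × ℕ)) (ws : List Bool) :
    ∃ z, nandRun gs ws = ws ++ z ∧ z.length = gs.length := by
  induction gs generalizing ws with
  | nil => exact ⟨[], by simp [nandRun]⟩
  | cons g gs ih =>
    obtain ⟨z, hz, hl⟩ := ih (ws ++ [!(wire ws g.1 && wire ws g.2)])
    refine ⟨[!(wire ws g.1 && wire ws g.2)] ++ z, ?_, by simp [hl]⟩
    rw [nandRun] at hz ⊢
    rw [List.foldl_cons, hz, List.append_assoc]

theorem length_nandRun (gs : List (ℕ × ℕ)) (ws : List Bool) :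
    (nandRun gs ws).length = ws.length + gs.length := by
  obtain ⟨z, hz, hl⟩ := nandRun_eq_append gs ws
  simp [hz, hl]

theorem map_wire_nandRun {ws : List Bool} {L : List ℕ} (h : ∀ i ∈ L, i < ws.length)
    (gs : List (ℕ × ℕ)) : L.map (wire (nandRun gs ws)) = L.map (wire ws) := by
  obtain ⟨z, hz, -⟩ := nandRun_eq_append gs ws
  rw [hz, map_wire_append h]

/-- The new number of a wire of a circuit that is plugged into a larger one with `N` wires, its
inputs being the wires `ins`. -/
def relocate (N : ℕ) (ins : List ℕ) (i : ℕ) : ℕ :=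
  if i < ins.length then ins.getD i 0 else N + (i - ins.length)

theorem wire_relocate {N : ℕ} {ins : List ℕ} {ws : List Bool} (hN : ws.length = N)
    (hins : ∀ i ∈ ins, i < N) (y : List Bool) (i : ℕ) :
    wire (ws ++ y) (relocate N ins i) = wire (ins.map (wire ws) ++ y) i := by
  subst hN
  unfold relocate
  split_ifs with h
  · have h1 : ins.getD i 0 = ins[i] := by simp [h]
    rw [h1, wire_append_left (hins _ (List.getElem_mem h)), wire_append_left (by simpa using h)]
    simp [wire, h]
  · obtain ⟨j, rfl⟩ := Nat.exists_eq_add_of_le (not_lt.1 h)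
    have h2 := wire_append_right (ins.map (wire ws)) y j
    rw [List.length_map] at h2
    rw [h2, Nat.add_sub_cancel_left, wire_append_right]

/-- `y` stands for the gate values produced so far, which makes the induction go through. The
plugged-in circuit appends exactly the bits that it appends on its own. -/
theorem nandRun_relocate {N : ℕ} {ins : List ℕ} {ws : List Bool} (hN : ws.length = N)
    (hins : ∀ i ∈ ins, i < N) (gs : List (ℕ × ℕ)) (y : List Bool) :
    ∃ z, nandRun gs (ins.map (wire ws) ++ y) = ins.map (wire ws) ++ z ∧
      nandRun (gs.map (Prod.map (relocate N ins) (relocate N ins))) (ws ++ y) = ws ++ z := by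
  induction gs generalizing y with
  | nil => exact ⟨y, by simp [nandRun]⟩
  | cons g gs ih =>
    obtain ⟨z, h1, h2⟩ := ih (y ++ [!(wire (ins.map (wire ws) ++ y) g.1 &&
      wire (ins.map (wire ws) ++ y) g.2)])
    refine ⟨z, ?_, ?_⟩
    · rw [nandRun] at h1 ⊢
      rw [← h1]; simp
    · rw [nandRun] at h2 ⊢
      rw [← h2]
      simp only [List.map_cons, List.foldl_cons, Prod.map_fst, Prod.map_snd,
        wire_relocate hN hins, List.append_assoc]

/-- `g x` is computed from `f x`, which consists of `a` bits, by a circuit of `s` NAND gates. -/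
def Computes {α : Type*} (a s : ℕ) (f g : α → List Bool) : Prop :=
  (∀ x, (f x).length = a) ∧ ∃ (gs : List (ℕ × ℕ)) (out : List ℕ), gs.length ≤ s ∧
    (∀ i ∈ out, i < a + gs.length) ∧ ∀ x, out.map (wire (nandRun gs (f x))) = g x

/-! ### A cost calculus for NAND circuits. -/

namespace Computes

variable {α : Type*} {a b s t u : ℕ} {f g h : α → List Bool}

theorem mono (H : Computes a s f g) (hst : s ≤ t) : Computes a t f g := by
  obtain ⟨h1, gs, out, h2, h3⟩ := H
  exact ⟨h1, gs, out, h2.trans hst, h3⟩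

theorem congr (H : Computes a s f g) (hg : ∀ x, g x = h x) : Computes a s f h := by
  rwa [← funext hg]

/-- Used to place a circuit inside a larger one. Gates and output pins are chosen before the input
`x`, so a single circuit serves all inputs; the number of pins is recorded because it becomes the
length of an oracle query. -/
theorem embed (H : Computes a s f g) {N : ℕ} {ins : List ℕ} (hins : ∀ i ∈ ins, i < N)
    (hl : ins.length = a) :
    ∃ (gs : List (ℕ × ℕ)) (out : List ℕ), gs.length ≤ s ∧ (∀ i ∈ out, i < N + gs.length) ∧
      (∀ x, out.length = (g x).length) ∧ ∀ ws x, ws.length = N → ins.map (wire ws) = f x →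
        out.map (wire (nandRun gs ws)) = g x := by
  obtain ⟨h1, gs, out, h2, h3, h4⟩ := H
  refine ⟨gs.map (Prod.map (relocate N ins) (relocate N ins)), out.map (relocate N ins),
    by simpa using h2, ?_, fun x => by rw [← h4 x, List.length_map, List.length_map], ?_⟩
  · simp only [List.mem_map, forall_exists_index, and_imp, forall_apply_eq_imp_iff₂,
      List.length_map]
    intro i hi
    unfold relocate
    split_ifs with h
    · have h5 : ins.getD i 0 = ins[i] := by simp [h]
      have := hins _ (List.getElem_mem h)
      omega
    · have := h3 i hi
      omega
  · intro ws x hN hx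
    obtain ⟨z, e1, e2⟩ := nandRun_relocate hN hins gs []
    rw [List.append_nil] at e1 e2
    rw [← h4 x, ← hx, e1, e2, List.map_map]
    exact List.map_congr_left fun i _ => wire_relocate hN hins z i

theorem trans (H : Computes a s f g) (H' : Computes b t g h) : Computes a (s + t) f h := by
  obtain ⟨h1, gs, out, h2, h3, h4⟩ := H
  refine ⟨h1, ?_⟩
  -- Over an empty `α` nothing ties the number of output pins to `b`, so the embedding is
  -- unavailable; the empty circuit serves there.
  rcases isEmpty_or_nonempty α with hα | ⟨⟨x₀⟩⟩
  · exact ⟨[], [], by simp⟩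
  · have hl : out.length = b := by
      rw [← H'.1 x₀, ← h4 x₀, List.length_map]
    obtain ⟨gs', out', e1, e2, -, e3⟩ := H'.embed h3 hl
    refine ⟨gs ++ gs', out', by simp; omega, by simpa [add_assoc] using e2, fun x => ?_⟩
    rw [nandRun_append]
    exact e3 _ x (by rw [length_nandRun, h1]) (h4 x)

theorem append (H : Computes a s f g) (H' : Computes a t f h) :
    Computes a (s + t) f fun x => g x ++ h x := by
  obtain ⟨h1, gs, out, h2, h3, h4⟩ := H
  obtain ⟨gs', out', e1, e2, -, e3⟩ := H'.embed (N := a + gs.length) (ins := List.range a)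
    (by intro i hi; rw [List.mem_range] at hi; omega) (by simp)
  refine ⟨h1, gs ++ gs', out ++ out', by simp; omega, ?_, fun x => ?_⟩
  · intro i hi
    rcases List.mem_append.1 hi with hi | hi
    · have := h3 i hi; simp; omega
    · have := e2 i hi; simp; omega
  · have hl : (nandRun gs (f x)).length = a + gs.length := by rw [length_nandRun, h1]
    rw [List.map_append, nandRun_append, map_wire_nandRun (by simpa [hl] using h3), h4,
      e3 _ x hl]
    rw [map_wire_nandRun (by simp [h1]), ← h1 x, map_wire_range]

theorem select (hf : ∀ x, (f x).length = a) {L : List ℕ} (hL : ∀ i ∈ L, i < a) :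
    Computes a 0 f fun x => L.map (wire (f x)) :=
  ⟨hf, [], L, by simp, by simpa using hL, fun x => by simp [nandRun]⟩

theorem refl (hf : ∀ x, (f x).length = a) : Computes a 0 f f :=
  (select hf (L := List.range a) (by simp)).congr fun x => by rw [← hf x, map_wire_range]

theorem left (hg : ∀ x, (g x).length = a) (hh : ∀ x, (h x).length = b) :
    Computes (a + b) 0 (fun x => g x ++ h x) g :=
  (select (by simp [hg, hh]) (L := List.range a) (by simp; omega)).congr fun x => by
    rw [map_wire_append (by simp [hg]), ← hg x, map_wire_range]

theorem right (hg : ∀ x, (g x).length = a) (hh : ∀ x, (h x).length = b) :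
    Computes (a + b) 0 (fun x => g x ++ h x) h :=
  (select (by simp [hg, hh]) (L := List.range' a b) (by simp)).congr fun x => by
    rw [← hg x, ← hh x, map_wire_range']

theorem const (hf : ∀ x, (f x).length = a) (l : List Bool) : Computes a 2 f fun _ => l := by
  -- Wire `a` does not exist yet and reads `false`, so the first gate yields `true` at position `a`;
  -- the second then reads that wire and yields `false` at `a + 1`.
  refine ⟨hf, [(a, a), (a, a)], l.map fun b => if b then a else a + 1, by simp, ?_, fun x => ?_⟩
  · simp only [List.mem_map, forall_exists_index, and_imp, forall_apply_eq_imp_iff₂]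
    intro b _
    cases b <;> simp
  · have e : nandRun [(a, a), (a, a)] (f x) = f x ++ [true, false] := by
      have e1 : wire (f x) a = false := wire_eq_false (hf x).le
      have e2 := wire_append_right (f x) [true] 0
      rw [hf, add_zero] at e2
      simp only [nandRun, List.foldl_cons, List.foldl_nil, e1]
      simp only [Bool.and_false, Bool.not_false, e2]
      simp [wire]
    rw [e, List.map_map]
    conv_rhs => rw [← List.map_id l]
    refine List.map_congr_left fun b _ => ?_
    have e0 := wire_append_right (f x) [true, false] 0
    have e1 := wire_append_right (f x) [true, false] 1
    rw [hf] at e0 e1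
    cases b
    · simpa [wire] using e1
    · simpa [wire] using e0

theorem nil (hf : ∀ x, (f x).length = a) : Computes a 0 f fun _ => [] :=
  select hf (L := []) (by simp)

theorem of_bits {m : ℕ} (hf : ∀ x, (f x).length = a) (hg : ∀ x, (g x).length = m)
    (H : ∀ i < m, Computes a s f fun x => [wire (g x) i]) : Computes a (m * s) f g := by
  have key : ∀ k ≤ m, Computes a (k * s) f fun x => (List.range k).map (wire (g x)) := by
    intro k hk
    induction k with
    | zero => simpa using nil hf
    | succ k ih =>
      rw [Nat.succ_mul]
      refine ((ih (by omega)).append (H k (by omega))).congr fun x => ?_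
      simp [List.range_succ]
  exact (key m le_rfl).congr fun x => by rw [← hg x, map_wire_range]

/-- Indices beyond the input are allowed: they read `false`, and are replaced by an explicit
constant so that they keep this value inside a larger circuit. -/
theorem wires (hf : ∀ x, (f x).length = a) (L : List ℕ) :
    Computes a (L.length * 2) f fun x => L.map (wire (f x)) := by
  refine of_bits hf (fun x => List.length_map _) fun i hi => ?_
  by_cases h : L[i] < a
  · exact ((select hf (L := [L[i]]) (by simpa using h)).congr fun x => by
      simp [wire, hi]).mono (by omega)
  · exact (const hf [false]).congr fun x => by
      have e : wire (L.map (wire (f x))) i = wire (f x) L[i] := by simp [wire, hi]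
      rw [e, wire_eq_false (by rw [hf]; omega)]

theorem bit (hf : ∀ x, (f x).length = a) (i : ℕ) :
    Computes a 2 f fun x => [wire (f x) i] :=
  wires hf [i]

theorem circuit (hf : ∀ x, (f x).length = a) (C : LogicCircuit) :
    Computes a (C.size * 3) f fun x => C.eval (f x) := by
  have h1 : Computes a C.gates.length f fun x => nandRun C.gates (f x) :=
    ⟨hf, C.gates, List.range (a + C.gates.length), le_rfl, by simp, fun x => by
      rw [← hf x, ← length_nandRun, map_wire_range]⟩
  refine ((h1.trans (b := a + C.gates.length) (wires (fun x => ?_) C.out)).congr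
    fun x => rfl).mono ?_
  · rw [length_nandRun, hf]
  · rw [LogicCircuit.size]; omega

section Bits

variable {p q r : α → Bool}

/-- Reduces a binary connective to its truth table, which `decide` checks at the output wire `i`. -/
theorem bool₂ (φ : Bool → Bool → Bool) (gs : List (ℕ × ℕ)) (i : ℕ) (hi : i < 2 + gs.length)
    (hφ : ∀ x y, wire (nandRun gs [x, y]) i = φ x y)
    (hp : Computes a s f fun x => [p x]) (hq : Computes a t f fun x => [q x]) :
    Computes a (s + t + gs.length) f fun x => [φ (p x) (q x)] :=
  (hp.append hq).trans (b := 2)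
    ⟨fun x => rfl, gs, [i], le_rfl, by simpa using hi, fun x => by simp [hφ]⟩

theorem and (hp : Computes a s f fun x => [p x]) (hq : Computes a t f fun x => [q x]) :
    Computes a (s + t + 4) f fun x => [p x && q x] :=
  (bool₂ (fun x y => x && y) [(0, 1), (2, 2)] 3 (by simp) (by decide) hp hq).mono (by simp)

theorem or (hp : Computes a s f fun x => [p x]) (hq : Computes a t f fun x => [q x]) :
    Computes a (s + t + 4) f fun x => [p x || q x] :=
  (bool₂ (fun x y => x || y) [(0, 0), (1, 1), (2, 3)] 4 (by simp) (by decide) hp hq).mono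
    (by simp)

theorem xor (hp : Computes a s f fun x => [p x]) (hq : Computes a t f fun x => [q x]) :
    Computes a (s + t + 4) f fun x => [Bool.xor (p x) (q x)] :=
  (bool₂ Bool.xor [(0, 1), (0, 2), (1, 2), (3, 4)] 5 (by simp) (by decide) hp hq).mono (by simp)

theorem nand (hp : Computes a s f fun x => [p x]) (hq : Computes a t f fun x => [q x]) :
    Computes a (s + t + 4) f fun x => [!(p x && q x)] :=
  (bool₂ (fun x y => !(x && y)) [(0, 1)] 2 (by simp) (by decide) hp hq).mono (by simp)

theorem not (hp : Computes a s f fun x => [p x]) : Computes a (s + 2) f fun x => [!p x] :=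
  hp.trans (b := 1) ⟨fun x => rfl, [(0, 0)], [1], by simp, by simp, fun x => by
    change [wire (nandRun [(0, 0)] [p x]) 1] = [!p x]
    cases p x <;> decide⟩

theorem beq (hp : Computes a s f fun x => [p x]) (hq : Computes a t f fun x => [q x]) :
    Computes a (s + t + 6) f fun x => [p x == q x] :=
  (hp.xor hq).not.congr fun x => by cases p x <;> cases q x <;> rfl

theorem bitIte (hp : Computes a s f fun x => [p x]) (hq : Computes a t f fun x => [q x])
    (hr : Computes a u f fun x => [r x]) :
    Computes a (2 * s + t + u + 14) f fun x => [if p x then q x else r x] :=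
  (((hp.and hq).or (hp.not.and hr)).congr fun x => by
    cases p x <;> cases q x <;> cases r x <;> rfl).mono (by omega)

end Bits

theorem all {p : ℕ → α → Bool} (hf : ∀ x, (f x).length = a) (m : ℕ)
    (H : ∀ i < m, Computes a s f fun x => [p i x]) :
    Computes a (m * (s + 4) + 2) f fun x => [(List.range m).all fun i => p i x] := by
  induction m with
  | zero => exact ((const hf [true]).congr fun x => by simp).mono (by omega)
  | succ m ih =>
    refine ((ih fun i hi => H i (by omega)).and (H m (by omega))).congr
      (fun x => by simp [List.range_succ]) |>.mono ?_
    rw [Nat.succ_mul]; omega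

theorem listEq {m : ℕ} (hg : Computes a s f g) (hh : Computes a t f h)
    (lg : ∀ x, (g x).length = m) (lh : ∀ x, (h x).length = m) :
    Computes a (s + t + (m * 14 + 2)) f fun x => [decide (g x = h x)] := by
  have hl : ∀ x, (g x ++ h x).length = m + m := by simp [lg, lh]
  refine (hg.append hh).trans (b := m + m) ?_
  -- Comparing two wires costs `2 + 2 + 6 = 10` gates, and the conjunction adds `4` per position,
  -- whence the factor `14`.
  refine (all (s := 10) (p := fun i x => wire (g x ++ h x) i == wire (g x ++ h x) (m + i))
    hl m fun i hi => ?_).congr fun x => ?_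
  · exact (beq (bit hl i) (bit hl (m + i))).mono (by omega)
  · congr 1
    rw [Bool.eq_iff_iff]
    simp only [List.all_eq_true, List.mem_range, beq_iff_eq, decide_eq_true_eq]
    constructor
    · intro H
      apply List.ext_getElem (by rw [lg, lh])
      intro i h1 h2
      have := H i (by rwa [lg] at h1)
      rw [wire_append_left h1] at this
      conv at this => rhs; rw [← lg x]
      rw [wire_append_right] at this
      simpa [wire, h1, h2] using this
    · intro H i hi
      rw [wire_append_left (by rwa [lg])]
      conv => rhs; rw [← lg x]
      rw [wire_append_right, H]

theorem ite {m : ℕ} {p : α → Bool} (hp : Computes a s f fun x => [p x])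
    (hg : Computes a t f g) (hh : Computes a u f h)
    (lg : ∀ x, (g x).length = m) (lh : ∀ x, (h x).length = m) :
    Computes a (s + (t + u) + m * 22) f fun x => if p x then g x else h x := by
  have hl : ∀ x, ([p x] ++ (g x ++ h x)).length = 1 + (m + m) := by simp [lg, lh]; omega
  refine (hp.append (hg.append hh)).trans (b := 1 + (m + m)) ?_
  refine of_bits hl (fun x => by split <;> simp [lg, lh]) fun i hi => ?_
  refine ((bitIte (bit hl 0) (bit hl (1 + i)) (bit hl (1 + (m + i)))).mono (by omega)).congr
    fun x => ?_
  have e0 : wire ([p x] ++ (g x ++ h x)) 0 = p x := by simp [wire]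
  have e1 : ∀ j, wire ([p x] ++ (g x ++ h x)) (1 + j) = wire (g x ++ h x) j := fun j =>
    wire_append_right [p x] _ j
  rw [e0, e1, e1, wire_append_left (by rwa [lg])]
  conv => lhs; rw [← lg x]
  rw [wire_append_right]
  split <;> rfl

end Computes

/-! ### Arithmetic circuits -/

theorem length_wordBits {n : ℕ} (x : BitVec n) : (wordBits x).length = n := by
  simp [wordBits]

theorem wire_wordBits {n : ℕ} (x : BitVec n) (i : ℕ) : wire (wordBits x) i = x.getLsbD i := by
  by_cases h : i < n
  · simp [wire, wordBits, h]
  · rw [wire_eq_false (by rw [length_wordBits]; omega), BitVec.getLsbD_of_ge _ _ (by omega)]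

theorem wordBits_injective {n : ℕ} : Function.Injective (wordBits (n := n)) := by
  intro x y h
  apply BitVec.eq_of_getLsbD_eq
  intro i _
  rw [← wire_wordBits, ← wire_wordBits, h]

theorem getLsbD_readWord {n : ℕ} (off : ℕ) (s : List Bool) {i : ℕ} (h : i < n) :
    (readWord n off s).getLsbD i = wire s (off + i) := by
  simp [readWord, wire, h]

theorem readWord_append {n off : ℕ} {s : List Bool} (hs : s.length = off) (x : BitVec n)
    (z : List Bool) : readWord n off (s ++ (wordBits x ++ z)) = x := by
  apply BitVec.eq_of_getLsbD_eq
  intro i hi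
  rw [getLsbD_readWord _ _ hi, ← hs, wire_append_right,
    wire_append_left (by rwa [length_wordBits]), wire_wordBits]

theorem wordBits_readWord (n off : ℕ) (s : List Bool) :
    wordBits (readWord n off s) = (List.range' off n).map (wire s) := by
  apply List.ext_getElem
  · simp [length_wordBits]
  · intro i h1 h2
    rw [length_wordBits] at h1
    have := wire_wordBits (readWord n off s) i
    rw [getLsbD_readWord _ _ h1] at this
    simpa [wire, length_wordBits, h1] using this

namespace Computes

variable {α : Type*} {a s t u n : ℕ} {f g : α → List Bool}

theorem readWord (hf : ∀ x, (f x).length = a) (n off : ℕ) :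
    Computes a (n * 2) f fun x => wordBits (readWord n off (f x)) :=
  ((wires hf (List.range' off n)).congr fun x => (wordBits_readWord _ _ _).symm).mono (by simp)

theorem carry (x y : α → BitVec n) {i : ℕ} (hi : i ≤ n) :
    Computes (n + n) (i * 30 + 2) (fun v => wordBits (x v) ++ wordBits (y v))
      fun v => [BitVec.carry i (x v) (y v) false] := by
  have hl : ∀ v, (wordBits (x v) ++ wordBits (y v)).length = n + n := by simp [length_wordBits]
  induction i with
  | zero => exact ((const hl [false]).congr fun v => by simp).mono (by omega)
  | succ i ih =>
    have hx : Computes (n + n) 2 (fun v => wordBits (x v) ++ wordBits (y v))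
        fun v => [(x v).getLsbD i] :=
      (bit hl i).congr fun v => by
        rw [wire_append_left (by rw [length_wordBits]; omega), wire_wordBits]
    have hy : Computes (n + n) 2 (fun v => wordBits (x v) ++ wordBits (y v))
        fun v => [(y v).getLsbD i] :=
      (bit hl (n + i)).congr fun v => by
        have := wire_append_right (wordBits (x v)) (wordBits (y v)) i
        rw [length_wordBits] at this
        rw [this, wire_wordBits]
    -- The majority is written with a single occurrence of the previous carry. Subcircuits are not
    -- shared in this calculus, so a second occurrence would make the cost exponential in `i`.
    refine (((hx.or hy).and (ih (by omega))).or (hx.and hy)).mono (by omega) |>.congr fun v => ?_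
    rw [BitVec.carry_succ]
    generalize (x v).getLsbD i = b, (y v).getLsbD i = c, BitVec.carry i (x v) (y v) false = d
    revert b c d
    decide

/-- Each sum bit recomputes its carry from the operands, hence the quadratic cost. -/
theorem add {x y : α → BitVec n} (hx : Computes a s f fun v => wordBits (x v))
    (hy : Computes a t f fun v => wordBits (y v)) :
    Computes a (s + t + n * (n * 30 + 14)) f fun v => wordBits (x v + y v) := by
  have hl : ∀ v, (wordBits (x v) ++ wordBits (y v)).length = n + n := by simp [length_wordBits]
  refine (hx.append hy).trans (b := n + n) ?_
  refine of_bits hl (fun v => length_wordBits _) fun i hi => ?_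
  have h1 := Nat.mul_le_mul_right 30 hi.le
  refine ((bit hl i).xor ((bit hl (n + i)).xor (carry x y hi.le))).mono (by omega)
    |>.congr fun v => ?_
  have := wire_append_right (wordBits (x v)) (wordBits (y v)) i
  rw [length_wordBits] at this
  rw [wire_append_left (by rwa [length_wordBits]), this, wire_wordBits, wire_wordBits,
    wire_wordBits, BitVec.getLsbD_add hi]

theorem complement {x : α → BitVec n} (hx : Computes a s f fun v => wordBits (x v)) :
    Computes a (s + n * 4) f fun v => wordBits (~~~(x v)) := by
  refine hx.trans (b := n) ?_
  refine of_bits (fun v => length_wordBits _) (fun v => length_wordBits _) fun i hi => ?_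
  refine (bit (fun v => length_wordBits _) i).not.congr fun v => ?_
  simp [wire_wordBits, hi]

theorem sub {x y : α → BitVec n} (hx : Computes a s f fun v => wordBits (x v))
    (hy : Computes a t f fun v => wordBits (y v)) :
    Computes a (s + t + (n * (n * 60 + 32) + 2)) f fun v => wordBits (x v - y v) := by
  refine (hx.add (hy.complement.add (const hy.1 (wordBits 1#n)))).mono ?_ |>.congr fun v => ?_
  · simp only [mul_add]
    ring_nf
    omega
  · rw [BitVec.sub_eq_add_neg, BitVec.neg_eq_not_add]

end Computes

/-! ### Tables of ciphertexts with their plaintexts -/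

/-- The bits of a plaintext. -/
def plainBits {n : ℕ} (m : BitVec w × BitVec n) : List Bool :=
  wordBits m.1 ++ wordBits m.2

/-- The bits of a ciphertext and the plaintext recorded with it. -/
def entryBits {ℓ n : ℕ} (e : BitVec ℓ × BitVec w × BitVec n) : List Bool :=
  wordBits e.1 ++ plainBits e.2

/-- The word recorded for a ciphertext under a given tag. -/
def lookup {ℓ n : ℕ} (g : BitVec w) (c : BitVec ℓ) :
    List (BitVec ℓ × BitVec w × BitVec n) → Option (BitVec n)
  | [] => none
  | e :: T => if e.1 = c ∧ e.2.1 = g then some e.2.2 else lookup g c T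

/-- The bits of an optional word. -/
def optionBits {n : ℕ} (o : Option (BitVec n)) : List Bool :=
  [o.isSome] ++ wordBits (o.getD 0)

theorem length_plainBits {n : ℕ} (m : BitVec w × BitVec n) : (plainBits m).length = w + n := by
  simp [plainBits, length_wordBits]

theorem length_entryBits {ℓ n : ℕ} (e : BitVec ℓ × BitVec w × BitVec n) :
    (entryBits e).length = ℓ + (w + n) := by
  simp [entryBits, length_wordBits, length_plainBits]

theorem length_flatMap_entryBits {ℓ n : ℕ} (T : List (BitVec ℓ × BitVec w × BitVec n)) :
    (T.flatMap entryBits).length = T.length * (ℓ + (w + n)) := by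
  simp [List.length_flatMap, length_entryBits]

/-- The number of gates that suffice to look up a word in a table of `t` entries. -/
def lookupCost (w ℓ n t : ℕ) : ℕ := t * (ℓ * 14 + w * 14 + n * 22 + 40) + 2

namespace Computes

variable {α : Type*} {a s t u n ℓ : ℕ} {f : α → List Bool} {c : α → BitVec ℓ}
  {T : α → List (BitVec ℓ × BitVec w × BitVec n)}

theorem wordEq {x y : α → BitVec n} (hx : Computes a s f fun v => wordBits (x v))
    (hy : Computes a t f fun v => wordBits (y v)) :
    Computes a (s + t + (n * 14 + 2)) f fun v => [decide (x v = y v)] :=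
  (hx.listEq hy (fun _ => length_wordBits _) fun _ => length_wordBits _).congr fun v => by
    simp [wordBits_injective.eq_iff]

/-- The ciphertext and the table are required at cost `0`, as selections of wires, because the
recursion reads the ciphertext again for every entry. `lookup` first computes both and then applies
this to the resulting bits, so their costs are paid once. -/
theorem lookup_aux (g : BitVec w) (hc : Computes a 0 f fun x => wordBits (c x))
    (hT : Computes a 0 f fun x => (T x).flatMap entryBits) (ht : ∀ x, (T x).length = t) :
    Computes a (lookupCost w ℓ n t) f fun x => optionBits (lookup g (c x) (T x)) := by
  induction t generalizing T with
  | zero =>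
    exact ((const hc.1 (optionBits (none : Option (BitVec n)))).congr fun x => by
      rw [List.length_eq_zero_iff.1 (ht x)]; rfl).mono (by simp [lookupCost])
  | succ t ih =>
    have h : ∀ x, ∃ e T', T x = e :: T' ∧ T'.length = t := fun x => by
      obtain ⟨e, T', h⟩ := List.exists_cons_of_length_eq_add_one (ht x)
      exact ⟨e, T', h, by simpa [h] using ht x⟩
    choose e T' hT' ht' using h
    have hT2 := hT.congr (h := fun x => entryBits (e x) ++ (T' x).flatMap entryBits)
      fun x => by rw [hT' x, List.flatMap_cons]
    have l2 : ∀ x, ((T' x).flatMap entryBits).length = t * (ℓ + (w + n)) := fun x => by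
      rw [length_flatMap_entryBits, ht']
    have he := (hT2.trans (left (fun x => length_entryBits (e x)) l2))
    have ht2 := (hT2.trans (right (fun x => length_entryBits (e x)) l2))
    have hct := he.trans (left (fun x => length_wordBits (e x).1) fun x => length_plainBits (e x).2)
    have hm := he.trans (right (fun x => length_wordBits (e x).1) fun x => length_plainBits (e x).2)
    have hg := hm.trans (left (fun x => length_wordBits (e x).2.1)
      fun x => length_wordBits (e x).2.2)
    have hv := hm.trans (right (fun x => length_wordBits (e x).2.1)
      fun x => length_wordBits (e x).2.2)
    have hp := (hct.wordEq hc).and (hg.wordEq (const hc.1 (wordBits g)))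
    refine ((hp.ite (m := 1 + n) ((const hc.1 [true]).append hv) (ih ht2 ht')
      (fun x => by simp [length_wordBits]; omega)
      (fun x => by simp [optionBits, length_wordBits]; omega)).congr fun x => ?_).mono ?_
    · rw [hT' x, lookup]
      simp only [Bool.and_eq_true, decide_eq_true_eq]
      split <;> rfl
    · simp only [lookupCost]
      ring_nf
      omega

theorem lookup (g : BitVec w) (hc : Computes a s f fun x => wordBits (c x))
    (hT : Computes a u f fun x => (T x).flatMap entryBits) (ht : ∀ x, (T x).length = t) :
    Computes a (s + u + lookupCost w ℓ n t) f fun x => optionBits (lookup g (c x) (T x)) := by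
  have l2 : ∀ x, ((T x).flatMap entryBits).length = t * (ℓ + (w + n)) := fun x => by
    rw [length_flatMap_entryBits, ht]
  exact (hc.append hT).trans (lookup_aux g (left (fun x => length_wordBits (c x)) l2)
    (right (fun x => length_wordBits (c x)) l2) ht)

theorem isSome {o : α → Option (BitVec n)} (ho : Computes a s f fun x => optionBits (o x)) :
    Computes a s f fun x => [(o x).isSome] :=
  ho.trans (left (a := 1) (b := n) (fun _ => rfl) fun _ => length_wordBits _)

theorem value {o : α → Option (BitVec n)} (ho : Computes a s f fun x => optionBits (o x)) :
    Computes a s f fun x => wordBits ((o x).getD 0) :=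
  ho.trans (right (a := 1) (b := n) (fun _ => rfl) fun _ => length_wordBits _)

end Computes

/-! ### The platform on a table of plaintexts -/

section TableOracle

variable (I : InstructionSet w) {n ℓ : ℕ}

/-- The content of the supplied word at position `i`, according to a table, if it is of kind
`κ`. -/
def operand (κ : WordKind I.Op I.Rel) (i : ℕ) (q : List Bool)
    (T : List (BitVec ℓ × BitVec w × BitVec n)) : Option (BitVec n) :=
  lookup (I.tag κ) (readWord ℓ (i * ℓ) q) T

/-- The plaintext result of an arithmetic instruction on words found in a table; `u` is the result
if a supplied word is not of the right kind. -/
def opResult (θ : I.Op) (q : List Bool) (T : List (BitVec ℓ × BitVec w × BitVec n))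
    (u : BitVec n) : BitVec n :=
  if (operand I (.opConst θ 0) 0 q T).isSome && (operand I (.opConst θ 1) 1 q T).isSome &&
      (operand I (.opConst θ 2) 2 q T).isSome && (operand I .data 3 q T).isSome &&
      (operand I .data 4 q T).isSome then
    I.eval θ n ((operand I .data 3 q T).getD 0 - (operand I (.opConst θ 1) 1 q T).getD 0)
      ((operand I .data 4 q T).getD 0 - (operand I (.opConst θ 2) 2 q T).getD 0) +
        (operand I (.opConst θ 0) 0 q T).getD 0
  else u

/-- The result of a test on words found in a table; `u` is the result if a supplied word is not of
the right kind. -/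
def testResult (R : I.Rel) (q : List Bool) (T : List (BitVec ℓ × BitVec w × BitVec n))
    (u : Bool) : Bool :=
  if (operand I (.relConst R 0) 0 q T).isSome && (operand I (.relConst R 1) 1 q T).isSome &&
      (operand I .data 2 q T).isSome && (operand I .data 3 q T).isSome then
    I.test R n ((operand I .data 2 q T).getD 0 - (operand I (.relConst R 0) 0 q T).getD 0)
      ((operand I .data 3 q T).getD 0 - (operand I (.relConst R 1) 1 q T).getD 0)
  else u

/-- The platform, computing with a table of plaintexts in place of decryption.  It also accepts
requests to encrypt a plaintext. -/
noncomputable def tableOracle {σ : Type} (e : BitVec w × BitVec n → PMF (BitVec ℓ))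
    (upd : σ → BitVec ℓ → σ) :
    (I.Op ⊕ I.Rel) ⊕ (BitVec w × BitVec n) → List Bool →
      List (BitVec ℓ × BitVec w × BitVec n) × σ →
        PMF (List Bool × (List (BitVec ℓ × BitVec w × BitVec n) × σ))
  | .inl (.inl θ), q, s =>
      (PMF.uniformOfFintype (BitVec n)).bind fun u =>
        (e (I.tag .data, opResult I θ q s.1 u)).map fun c =>
          (wordBits c, (c, I.tag .data, opResult I θ q s.1 u) :: s.1, upd s.2 c)
  | .inl (.inr R), q, s =>
      (PMF.uniformOfFintype Bool).map fun u => ([testResult I R q s.1 u], s)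
  | .inr m, _, s => (e m).map fun c => (wordBits c, s.1 ++ [(c, m)], upd s.2 c)

/-- Adds an offset to the word of a plaintext. -/
def shift (δ : BitVec n) (m : BitVec w × BitVec n) : BitVec w × BitVec n := (m.1, m.2 + δ)

/-- The query to the left-or-right oracle for a plaintext and its shift. -/
def shiftQuery (δ : BitVec n) (m : BitVec w × BitVec n) : List Bool :=
  plainBits m ++ plainBits (shift δ m)

/-- An oracle that encrypts a selection of two plaintexts. -/
noncomputable def selOracle {σ : Type} (enc : BitVec w × BitVec n → PMF (BitVec ℓ))
    (sel : BitVec w × BitVec n → BitVec w × BitVec n → BitVec w × BitVec n)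
    (upd : σ → BitVec ℓ → σ) : Unit → List Bool → σ → PMF (List Bool × σ) := fun _ q s =>
  (enc (sel (Encryption.readPlain w n 0 q) (Encryption.readPlain w n (w + n) q))).map fun c =>
    (wordBits c, upd s c)

theorem readPlain_append {off : ℕ} {s : List Bool} (hs : s.length = off)
    (m : BitVec w × BitVec n) (z : List Bool) :
    Encryption.readPlain w n off (s ++ (plainBits m ++ z)) = m := by
  have h1 := readWord_append hs m.1 (wordBits m.2 ++ z)
  have h2 := readWord_append (s := s ++ wordBits m.1) (off := off + w)
    (by simp [hs, length_wordBits]) m.2 z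
  rw [Encryption.readPlain, plainBits, List.append_assoc, h1]
  rw [List.append_assoc] at h2
  rw [h2]

theorem selOracle_shiftQuery {σ : Type} (enc : BitVec w × BitVec n → PMF (BitVec ℓ))
    (sel : BitVec w × BitVec n → BitVec w × BitVec n → BitVec w × BitVec n)
    (upd : σ → BitVec ℓ → σ) (δ : BitVec n) (m : BitVec w × BitVec n) (x : Unit) (s : σ) :
    selOracle enc sel upd x (shiftQuery δ m) s =
      (enc (sel m (shift δ m))).map fun c => (wordBits c, upd s c) := by
  have h1 := readPlain_append (off := 0) (s := []) rfl m (plainBits (shift δ m))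
  have h2 := readPlain_append (length_plainBits m) (shift δ m) []
  rw [List.nil_append] at h1
  rw [List.append_nil] at h2
  rw [selOracle, shiftQuery, h1, h2]

end TableOracle

/-- The number of gates that suffice for an instruction on words found in a table of `t` entries,
for a query computed by `s` gates and an arithmetic unit of size `S`. -/
def instrCost (w ℓ n t s S : ℕ) : ℕ :=
  10 * (s + ℓ * 2 + lookupCost w ℓ n t) + n * (n * 150 + 100) + 3 * S + 50

namespace Computes

variable {α : Type*} {a s t n ℓ v S : ℕ} {f q : α → List Bool}
  {T : α → List (BitVec ℓ × BitVec w × BitVec n)} (I : InstructionSet w)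

theorem operand (κ : WordKind I.Op I.Rel) (i : ℕ) (hq : Computes a s f q)
    (hl : ∀ x, (q x).length = v) (hT : Computes a 0 f fun x => (T x).flatMap entryBits)
    (ht : ∀ x, (T x).length = t) :
    Computes a (s + ℓ * 2 + lookupCost w ℓ n t) f
      fun x => optionBits (operand I κ i (q x) (T x)) :=
  (lookup (s := s + ℓ * 2) _ (hq.trans (readWord hl ℓ (i * ℓ))) hT ht).mono (by omega)

theorem evalCircuit (C : LogicCircuit) (hC : C.size ≤ S) {u : ℕ} {x y : α → BitVec n}
    {φ : BitVec n → BitVec n → List Bool}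
    (h : ∀ x y, C.eval (wordBits x ++ wordBits y) = φ x y)
    (hx : Computes a s f fun v => wordBits (x v)) (hy : Computes a u f fun v => wordBits (y v)) :
    Computes a (s + u + 3 * S) f fun v => φ (x v) (y v) :=
  ((hx.append hy).trans (b := n + n) ((circuit (by simp [length_wordBits]) C).congr
    fun v => h _ _)).mono (by omega)

theorem opResult {θ : I.Op} (C : LogicCircuit) (hC : C.size ≤ S)
    (hθ : ∀ x y, C.eval (wordBits x ++ wordBits y) = wordBits (I.eval θ n x y))
    (hq : Computes a s f q) (hl : ∀ x, (q x).length = v)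
    (hT : Computes a 0 f fun x => (T x).flatMap entryBits) (ht : ∀ x, (T x).length = t)
    {u : α → BitVec n} (hu : Computes a 0 f fun x => wordBits (u x)) :
    Computes a (instrCost w ℓ n t s S) f
      fun x => wordBits (opResult I θ (q x) (T x) (u x)) := by
  have H := fun κ i => operand I κ i hq hl hT ht
  have hb := ((((H (.opConst θ 0) 0).isSome.and (H (.opConst θ 1) 1).isSome).and
    (H (.opConst θ 2) 2).isSome).and (H .data 3).isSome).and (H .data 4).isSome
  have hv := (evalCircuit C hC hθ ((H .data 3).value.sub (H (.opConst θ 1) 1).value)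
    ((H .data 4).value.sub (H (.opConst θ 2) 2).value)).add (H (.opConst θ 0) 0).value
  refine ((hb.ite hv hu (fun _ => length_wordBits _) fun _ => length_wordBits _).congr
    fun x => ?_).mono ?_
  · rw [_root_.opResult]
    split <;> rfl
  -- Each of the five operands is computed twice, for its validity and for its value, whence the
  -- factor `10` in `instrCost`.
  · simp only [instrCost]
    ring_nf
    omega

theorem testResult {R : I.Rel} (C : LogicCircuit) (hC : C.size ≤ S)
    (hR : ∀ x y, C.eval (wordBits x ++ wordBits y) = [I.test R n x y])
    (hq : Computes a s f q) (hl : ∀ x, (q x).length = v)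
    (hT : Computes a 0 f fun x => (T x).flatMap entryBits) (ht : ∀ x, (T x).length = t)
    {u : α → Bool} (hu : Computes a 0 f fun x => [u x]) :
    Computes a (instrCost w ℓ n t s S) f fun x => [testResult I R (q x) (T x) (u x)] := by
  have H := fun κ i => operand I κ i hq hl hT ht
  have hb := (((H (.relConst R 0) 0).isSome.and (H (.relConst R 1) 1).isSome).and
    (H .data 2).isSome).and (H .data 3).isSome
  have hv := evalCircuit C hC hR ((H .data 2).value.sub (H (.relConst R 0) 0).value)
    ((H .data 3).value.sub (H (.relConst R 1) 1).value)
  refine ((hb.ite (m := 1) hv hu (fun _ => rfl) fun _ => rfl).congr fun x => ?_).mono ?_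
  · rw [_root_.testResult]
    split <;> rfl
  · simp only [instrCost]
    ring_nf
    omega

theorem shiftQuery {g : BitVec w} {y : α → BitVec n} (δ : BitVec n)
    (hy : Computes a s f fun x => wordBits (y x)) :
    Computes a (s + (n * (n * 30 + 14) + 6)) f fun x => shiftQuery δ (g, y x) := by
  have h0 : Computes n 0 (fun x => wordBits (y x)) fun x => wordBits (y x) :=
    refl fun _ => length_wordBits _
  -- Passing through the `n` bits of `y x` pays for them once, although they occur in both halves of
  -- the query. The tag and `δ` are hardwired.
  exact hy.trans (b := n) ((((const h0.1 (wordBits g)).append h0).append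
    ((const h0.1 (wordBits g)).append (h0.add (const h0.1 (wordBits δ))))).mono (by omega))

end Computes

/-! ### Running gates -/

section RunGates

variable {κ σ : Type} (O : κ → List Bool → σ → PMF (List Bool × σ))

theorem runGates_nand (gs : List (ℕ × ℕ)) (rest : List (Gate κ)) (ws : List Bool) (s : σ) :
    runGates O (gs.map (fun g => .nand g.1 g.2) ++ rest) ws s =
      runGates O rest (nandRun gs ws) s := by
  induction gs generalizing ws with
  | nil => rfl
  | cons g gs ih =>
    rw [List.map_cons, List.cons_append, runGates, ih]
    rfl

theorem sum_cost_nand (gs : List (ℕ × ℕ)) :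
    ((gs.map fun g => (.nand g.1 g.2 : Gate κ)).map Gate.cost).sum = gs.length := by
  induction gs with
  | nil => rfl
  | cons g gs ih =>
    simp only [List.map_cons, List.sum_cons, ih, Gate.cost, List.length_cons]
    omega

theorem runGates_append (gs hs : List (Gate κ)) (ws : List Bool) (s : σ) :
    runGates O (gs ++ hs) ws s = (runGates O gs ws s).bind fun r => runGates O hs r.1 r.2 := by
  induction gs generalizing ws s with
  | nil => simp [runGates]
  | cons g gs ih =>
    cases g <;> simp [runGates, ih, PMF.bind_bind]

end RunGates

theorem uniformOfFintype_prod_equiv {α β γ : Type} [Fintype α] [Nonempty α] [Fintype β]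
    [Nonempty β] [Fintype γ] [Nonempty γ] (e : α × β ≃ γ) :
    PMF.uniformOfFintype γ = (PMF.uniformOfFintype α).bind fun a =>
      (PMF.uniformOfFintype β).map fun b => e (a, b) := by
  classical
  ext y
  have hc : Fintype.card γ = Fintype.card α * Fintype.card β := by
    rw [← Fintype.card_prod, Fintype.card_congr e]
  obtain ⟨⟨a, b⟩, rfl⟩ := e.surjective y
  simp only [PMF.bind_apply, PMF.map_apply, PMF.uniformOfFintype_apply, tsum_fintype, hc,
    e.injective.eq_iff, Prod.mk.injEq]
  rw [Finset.sum_eq_single a, Finset.sum_eq_single b]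
  · simp only [and_self, if_true]
    rw [Nat.cast_mul, ENNReal.mul_inv] <;> simp
  · intro b' _ h
    simp [h.symm]
  · simp
  · intro a' _ h
    simp [h.symm]
  · simp

theorem map_uniformOfFintype_equiv {α β : Type} [Fintype α] [Nonempty α] [Fintype β]
    [Nonempty β] (e : α ≃ β) :
    (PMF.uniformOfFintype α).map e = PMF.uniformOfFintype β := by
  classical
  ext y
  obtain ⟨a, rfl⟩ := e.surjective y
  simp only [PMF.map_apply, PMF.uniformOfFintype_apply, tsum_fintype, e.injective.eq_iff,
    Fintype.card_congr e]
  simp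

/-- Independent coins, least significant bit first, form a uniform word. -/
theorem runGates_coins {κ σ : Type} (O : κ → List Bool → σ → PMF (List Bool × σ)) (n : ℕ)
    (rest : List (Gate κ)) (ws : List Bool) (s : σ) :
    runGates O (List.replicate n .coin ++ rest) ws s =
      (PMF.uniformOfFintype (BitVec n)).bind fun u => runGates O rest (ws ++ wordBits u) s := by
  induction n generalizing ws with
  | zero =>
    have h : ∀ u : BitVec 0, wordBits u = [] := fun u => rfl
    simp [h]
  | succ n ih =>
    let e : Bool × BitVec n ≃ BitVec (n + 1) :=
      { toFun := fun p => p.2.concat p.1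
        invFun := fun x => (x.getLsbD 0, x.extractLsb' 1 n)
        left_inv := fun p => by
          refine Prod.ext (by simp) ?_
          apply BitVec.eq_of_getLsbD_eq
          intro i hi
          simp [hi, add_comm 1 i]
        right_inv := fun x => by
          apply BitVec.eq_of_getLsbD_eq
          intro i hi
          rcases i with _ | i
          · simp
          · simp [add_comm 1 i, Nat.lt_of_succ_lt_succ hi] }
    have h : ∀ b (u : BitVec n), wordBits (e (b, u)) = [b] ++ wordBits u := by
      intro b u
      apply List.ext_getElem
      · simp [length_wordBits]; try omega
      · intro i _ _
        rcases i with _ | i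
        · simp [e, wordBits]
        · simp [e, wordBits]
    rw [uniformOfFintype_prod_equiv e, List.replicate_succ, List.cons_append, runGates,
      PMF.bind_bind]
    refine congrArg _ (funext fun b => ?_)
    rw [ih, PMF.bind_map]
    refine congrArg _ (funext fun u => ?_)
    simp [h]

/-! ### Simulation of an operator by a circuit with a left-or-right oracle -/

/-- The factor by which a circuit grows when the platform is simulated with tables of at most `t`
entries and arithmetic units of size at most `S`. -/
def simFactor (w ℓ n t S : ℕ) : ℕ :=
  instrCost w ℓ n t 0 S + n * (n * 30 + 15) + 2 * (w + n) + 40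

theorem instrCost_mono {w ℓ n t t' : ℕ} (h : t ≤ t') (s S : ℕ) :
    instrCost w ℓ n t s S ≤ instrCost w ℓ n t' 0 S + 10 * s := by
  have := Nat.mul_le_mul_right (ℓ * 14 + w * 14 + n * 22 + 40) h
  simp only [instrCost, lookupCost]
  omega

/-- The arithmetic units of the processor for `n`-bit words have size at most `S`. -/
def UnitsOfSize (I : InstructionSet w) (n S : ℕ) : Prop :=
  (∀ θ, ∃ C : LogicCircuit, C.size ≤ S ∧
    ∀ x y, C.eval (wordBits x ++ wordBits y) = wordBits (I.eval θ n x y)) ∧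
  ∀ R, ∃ C : LogicCircuit, C.size ≤ S ∧
    ∀ x y, C.eval (wordBits x ++ wordBits y) = [I.test R n x y]

/-- `fin` is computed by `F` gates from a string and the bits of a table of at most `t` entries. -/
def FinalComputes (w ℓ n t F : ℕ)
    (fin : List Bool → List (BitVec ℓ × BitVec w × BitVec n) → List Bool) : Prop :=
  ∀ a b, b ≤ t → Computes (a + b * (ℓ + (w + n))) F
    (fun x : {x : List Bool × List (BitVec ℓ × BitVec w × BitVec n) //
      x.1.length = a ∧ x.2.length = b} => x.1.1 ++ x.1.2.flatMap entryBits)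
    fun x => fin x.1.1 x.1.2

section Simulation

variable {I : InstructionSet w} {n ℓ : ℕ} (δ : BitVec n)
  (fin : List Bool → List (BitVec ℓ × BitVec w × BitVec n) → List Bool)

/-- The circuit with gates `gs'` and output `out`, started with `N` wires among which those at
`pos` and `tpos` hold the wires of the operator and the table of `t` entries, computes `fin` of the
outcome of the gates `gs`. -/
def Simulates (I : InstructionSet w) (gs : List (Gate ((I.Op ⊕ I.Rel) ⊕ (BitVec w × BitVec n))))
    (N : ℕ) (pos tpos : List ℕ) (t : ℕ) (gs' : List (Gate Unit)) (out : List ℕ) : Prop :=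
  ∀ {σ : Type} (enc : BitVec w × BitVec n → PMF (BitVec ℓ))
    (sel : BitVec w × BitVec n → BitVec w × BitVec n → BitVec w × BitVec n)
    (upd : σ → BitVec ℓ → σ) (ws : List Bool)
    (T : List (BitVec ℓ × BitVec w × BitVec n)) (s : σ), ws.length = N → T.length = t →
      tpos.map (wire ws) = T.flatMap entryBits →
      (runGates (selOracle enc sel upd) gs' ws s).map (fun r => (out.map (wire r.1), r.2)) =
        (runGates (tableOracle I (fun m => enc (sel m (shift δ m))) upd) gs
          (pos.map (wire ws)) (T, s)).map fun r => (fin r.1 r.2.1, r.2.2)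

variable {δ fin} {N : ℕ} {pos tpos : List ℕ} {t : ℕ}

theorem Simulates.step {σ : Type} {enc : BitVec w × BitVec n → PMF (BitVec ℓ)}
    {sel : BitVec w × BitVec n → BitVec w × BitVec n → BitVec w × BitVec n}
    {upd : σ → BitVec ℓ → σ} {gs : List (Gate ((I.Op ⊕ I.Rel) ⊕ (BitVec w × BitVec n)))}
    {gs' : List (Gate Unit)} {out : List ℕ}
    (H : Simulates δ fin I gs N pos tpos t gs' out) {ws : List Bool}
    {T : List (BitVec ℓ × BitVec w × BitVec n)} {s : σ} {vs : List Bool}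
    (h1 : ws.length = N) (h2 : T.length = t) (h3 : tpos.map (wire ws) = T.flatMap entryBits)
    (h4 : pos.map (wire ws) = vs) :
    (runGates (selOracle enc sel upd) gs' ws s).map (fun r => (out.map (wire r.1), r.2)) =
      (runGates (tableOracle I (fun m => enc (sel m (shift δ m))) upd) gs vs (T, s)).map
        fun r => (fin r.1 r.2.1, r.2.2) := by
  rw [← h4]
  exact H enc sel upd ws T s h1 h2 h3

theorem runGates_ask_selOracle {σ : Type} (enc : BitVec w × BitVec n → PMF (BitVec ℓ))
    (sel : BitVec w × BitVec n → BitVec w × BitVec n → BitVec w × BitVec n)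
    (upd : σ → BitVec ℓ → σ) {L : List ℕ} {m : BitVec w × BitVec n} {ws : List Bool}
    (h : L.map (wire ws) = shiftQuery δ m) (gs : List (Gate Unit)) (s : σ) :
    runGates (selOracle enc sel upd) (.ask () L :: gs) ws s =
      (enc (sel m (shift δ m))).bind fun c =>
        runGates (selOracle enc sel upd) gs (ws ++ wordBits c) (upd s c) := by
  rw [runGates, h, selOracle_shiftQuery, PMF.bind_map]
  rfl

variable {gs : List (Gate ((I.Op ⊕ I.Rel) ⊕ (BitVec w × BitVec n)))}

theorem exists_simulates_nil {F M Tmax : ℕ} (hfin : FinalComputes w ℓ n Tmax F fin)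
    (hM : ∀ v T, (fin v T).length ≤ M) (hpos : ∀ i ∈ pos, i < N) (htpos : ∀ i ∈ tpos, i < N)
    (htl : tpos.length = t * (ℓ + (w + n))) (ht : t ≤ Tmax) :
    ∃ gs' out, (gs'.map Gate.cost).sum ≤ F ∧ out.length ≤ M ∧
      Simulates δ fin I [] N pos tpos t gs' out := by
  have hC := hfin pos.length t ht
  obtain ⟨gs', out, h1, h2, hl, h3⟩ := hC.embed (N := N) (ins := pos ++ tpos)
    (by simpa [or_imp, forall_and] using ⟨hpos, htpos⟩) (by simp [htl])
  have hsim : ∀ (ws : List Bool) (T : List (BitVec ℓ × BitVec w × BitVec n)), ws.length = N →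
      T.length = t → tpos.map (wire ws) = T.flatMap entryBits →
      out.map (wire (nandRun gs' ws)) = fin (pos.map (wire ws)) T := by
    intro ws T hw hT hb
    exact h3 ws ⟨(pos.map (wire ws), T), by simp, hT⟩ hw (by rw [List.map_append, hb])
  refine ⟨gs'.map fun g => .nand g.1 g.2, out, by rwa [sum_cost_nand], ?_, ?_⟩
  · rw [hl ⟨(List.replicate pos.length false, List.replicate t (0, 0, 0)), by simp⟩]
    exact hM _ _
  · intro σ enc sel upd ws T s hw hT hb
    have := runGates_nand (selOracle enc sel upd) gs' [] ws s
    rw [List.append_nil] at this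
    rw [this]
    simp [runGates, PMF.pure_map, hsim ws T hw hT hb]

theorem exists_simulates_nand {B M : ℕ} (i j : ℕ) (hpos : ∀ i ∈ pos, i < N)
    (htpos : ∀ i ∈ tpos, i < N)
    (ih : ∀ N' pos', (∀ i ∈ pos', i < N') → (∀ i ∈ tpos, i < N') →
      ∃ gs' out, (gs'.map Gate.cost).sum ≤ B ∧ out.length ≤ M ∧
        Simulates δ fin I gs N' pos' tpos t gs' out) :
    ∃ gs' out, (gs'.map Gate.cost).sum ≤ 8 + B ∧ out.length ≤ M ∧
      Simulates δ fin I (.nand i j :: gs) N pos tpos t gs' out := by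
  have hl : ∀ x : {x : List Bool // x.length = pos.length}, x.1.length = pos.length := fun x => x.2
  obtain ⟨gs₀, out₀, h1, h2, -, h3⟩ := ((Computes.bit hl i).nand (Computes.bit hl j)).embed
    hpos rfl
  obtain ⟨gs₁, out, c1, c2, H⟩ := ih (N + gs₀.length) (pos ++ out₀)
    (by
      intro i hi
      rcases List.mem_append.1 hi with hi | hi
      · exact (hpos i hi).trans_le (by omega)
      · exact h2 i hi)
    fun i hi => (htpos i hi).trans_le (by omega)
  refine ⟨gs₀.map (fun g => .nand g.1 g.2) ++ gs₁, out, ?_, c2, ?_⟩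
  · rw [List.map_append, List.sum_append, sum_cost_nand]
    omega
  · intro σ enc sel upd ws T s hw hT hb
    subst hw
    rw [runGates_nand, runGates]
    refine H.step (length_nandRun _ _) hT ?_ ?_
    · rw [map_wire_nandRun htpos, hb]
    · rw [List.map_append, map_wire_nandRun hpos,
        h3 ws ⟨pos.map (wire ws), by simp⟩ rfl rfl]

theorem exists_simulates_coin {B M : ℕ} (hpos : ∀ i ∈ pos, i < N)
    (htpos : ∀ i ∈ tpos, i < N)
    (ih : ∀ N' pos', (∀ i ∈ pos', i < N') → (∀ i ∈ tpos, i < N') →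
      ∃ gs' out, (gs'.map Gate.cost).sum ≤ B ∧ out.length ≤ M ∧
        Simulates δ fin I gs N' pos' tpos t gs' out) :
    ∃ gs' out, (gs'.map Gate.cost).sum ≤ 1 + B ∧ out.length ≤ M ∧
      Simulates δ fin I (.coin :: gs) N pos tpos t gs' out := by
  obtain ⟨gs₁, out, c1, c2, H⟩ := ih (N + 1) (pos ++ [N])
    (by
      intro i hi
      rcases List.mem_append.1 hi with hi | hi
      · exact (hpos i hi).trans_le (by omega)
      · rw [List.mem_singleton.1 hi]; omega)
    fun i hi => (htpos i hi).trans_le (by omega)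
  refine ⟨.coin :: gs₁, out, by simpa [Gate.cost] using c1, c2, ?_⟩
  intro σ enc sel upd ws T s hw hT hb
  subst hw
  rw [runGates, runGates, PMF.map_bind, PMF.map_bind]
  refine congrArg _ (funext fun b => H.step (by simp) hT ?_ ?_)
  · rw [map_wire_append htpos, hb]
  · rw [List.map_append, map_wire_append hpos, List.map_singleton]
    congr 2
    exact wire_append_right ws [b] 0

theorem flatMap_length_const (T : List (BitVec ℓ × BitVec w × BitVec n)) (hT : T.length = t) :
    (T.flatMap entryBits).length = t * (ℓ + (w + n)) := by
  rw [length_flatMap_entryBits, hT]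

theorem map_wire_reply {ws : List Bool} (hw : ws.length = N) (c : BitVec ℓ) :
    (List.range' N ℓ).map (wire (ws ++ wordBits c)) = wordBits c := by
  have := map_wire_range' ws (wordBits c)
  rwa [length_wordBits, hw] at this

/-- The first half of a query is the unshifted plaintext; its wires are what the table keeps,
whichever side the oracle encrypts. -/
theorem map_wire_take {ws : List Bool} {L : List ℕ} {m : BitVec w × BitVec n}
    (h : L.map (wire ws) = shiftQuery δ m) :
    (L.take (w + n)).map (wire ws) = plainBits m := by
  rw [List.map_take, h, shiftQuery, List.take_left' (length_plainBits m)]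

theorem length_shiftQuery (m : BitVec w × BitVec n) :
    (shiftQuery δ m).length = 2 * (w + n) := by
  simp only [shiftQuery, List.length_append, length_plainBits]
  omega

/-- The circuit draws the nonsense word in advance, computes the result from the table, and asks the
oracle for an encryption of the result or its shift. The reply and the plaintext half of the query
are already on wires, so the new table entry costs no gates. -/
theorem exists_simulates_op {B M S : ℕ} {θ : I.Op} (C : LogicCircuit) (hC : C.size ≤ S)
    (hθ : ∀ x y, C.eval (wordBits x ++ wordBits y) = wordBits (I.eval θ n x y)) (q : List ℕ)
    (hpos : ∀ i ∈ pos, i < N) (htpos : ∀ i ∈ tpos, i < N)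
    (htl : tpos.length = t * (ℓ + (w + n)))
    (ih : ∀ N' pos' tpos', (∀ i ∈ pos', i < N') → (∀ i ∈ tpos', i < N') →
      tpos'.length = (t + 1) * (ℓ + (w + n)) →
      ∃ gs' out, (gs'.map Gate.cost).sum ≤ B ∧ out.length ≤ M ∧
        Simulates δ fin I gs N' pos' tpos' (t + 1) gs' out) :
    ∃ gs' out, (gs'.map Gate.cost).sum ≤ n + (instrCost w ℓ n t (q.length * 2) S +
        (n * (n * 30 + 14) + 6)) + (1 + 2 * (w + n)) + B ∧ out.length ≤ M ∧
      Simulates δ fin I (.ask (.inl (.inl θ)) q :: gs) N pos tpos t gs' out := by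
  let α := {x : List Bool × List (BitVec ℓ × BitVec w × BitVec n) × BitVec n //
    x.1.length = pos.length ∧ x.2.1.length = t}
  have l1 : ∀ x : α, x.1.1.length = pos.length := fun x => x.2.1
  have l2 : ∀ x : α, (x.1.2.1.flatMap entryBits).length = t * (ℓ + (w + n)) := fun x =>
    flatMap_length_const _ x.2.2
  have l3 : ∀ x : α, (wordBits x.1.2.2).length = n := fun x => length_wordBits _
  have l23 : ∀ x : α, (x.1.2.1.flatMap entryBits ++ wordBits x.1.2.2).length =
      t * (ℓ + (w + n)) + n := fun x => by rw [List.length_append, l2, l3]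
  have p1 := Computes.left l1 l23
  have p2 := (Computes.right l1 l23).trans (Computes.left l2 l3)
  have p3 := (Computes.right l1 l23).trans (Computes.right l2 l3)
  have hq := (p1.trans (Computes.wires l1 q)).mono (t := q.length * 2) (by omega)
  obtain ⟨gs₀, out₀, h1, h2, hl, h3⟩ := (Computes.shiftQuery (g := I.tag .data) δ
    (Computes.opResult I C hC hθ hq (fun x => List.length_map _) p2 (fun x => x.2.2) p3)).embed
      (N := N + n) (ins := pos ++ (tpos ++ List.range' N n))
      (by
        simp only [List.mem_append, List.mem_range'_1]
        rintro i (hi | hi | hi)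
        · exact (hpos i hi).trans_le (by omega)
        · exact (htpos i hi).trans_le (by omega)
        · exact hi.2)
      (by simp [htl])
  have hsim : ∀ (ws : List Bool) (T : List (BitVec ℓ × BitVec w × BitVec n)) (u : BitVec n),
      ws.length = N → T.length = t → tpos.map (wire ws) = T.flatMap entryBits →
      out₀.map (wire (nandRun gs₀ (ws ++ wordBits u))) = shiftQuery δ
        (I.tag .data, opResult I θ (q.map (wire (pos.map (wire ws)))) T u) := by
    intro ws T u hw hT hb
    refine h3 _ ⟨(pos.map (wire ws), T, u), by simp, hT⟩ (by simp [hw, length_wordBits]) ?_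
    rw [List.map_append, List.map_append, map_wire_append (by rwa [hw]),
      map_wire_append (by rwa [hw]), hb, map_wire_reply hw]
  have hlen : out₀.length = 2 * (w + n) := by
    rw [hl ⟨(List.replicate pos.length false, List.replicate t (0, 0, 0), 0), by simp⟩,
      length_shiftQuery]
  obtain ⟨gs₁, out, c1, c2, H⟩ := ih (N + n + gs₀.length + ℓ)
    (pos ++ List.range' (N + n + gs₀.length) ℓ)
    (List.range' (N + n + gs₀.length) ℓ ++ out₀.take (w + n) ++ tpos)
    (by
      simp only [List.mem_append, List.mem_range'_1]
      rintro i (hi | hi)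
      · exact (hpos i hi).trans_le (by omega)
      · exact hi.2)
    (by
      simp only [List.mem_append, List.mem_range'_1]
      rintro i ((hi | hi) | hi)
      · exact hi.2
      · exact (h2 i (List.mem_of_mem_take hi)).trans_le (by omega)
      · exact (htpos i hi).trans_le (by omega))
    (by
      simp only [List.length_append, List.length_range', List.length_take, hlen, htl]
      rw [min_eq_left (by omega)]
      ring)
  refine ⟨List.replicate n .coin ++ (gs₀.map (fun g => .nand g.1 g.2) ++ .ask () out₀ :: gs₁),
    out, ?_, c2, ?_⟩
  · simp only [List.map_append, List.sum_append, sum_cost_nand, List.map_replicate, Gate.cost,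
      List.sum_replicate, List.map_cons, List.sum_cons, hlen, smul_eq_mul, mul_one]
    omega
  · intro σ enc sel upd ws T s hw hT hb
    rw [runGates_coins, runGates, tableOracle, PMF.bind_bind, PMF.map_bind, PMF.map_bind]
    refine congrArg _ (funext fun u => ?_)
    have e := hsim ws T u hw hT hb
    have hl : (nandRun gs₀ (ws ++ wordBits u)).length = N + n + gs₀.length := by
      simp [length_nandRun, length_wordBits, hw]
    rw [runGates_nand, runGates_ask_selOracle _ _ _ e, PMF.bind_map, PMF.map_bind, PMF.map_bind]
    refine congrArg _ (funext fun c => H.step ?_ ?_ ?_ ?_)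
    · rw [List.length_append, hl, length_wordBits]
    · simp [hT]
    · rw [List.map_append, List.map_append, map_wire_reply hl, map_wire_append
        (fun i hi => by rw [hl]; exact h2 i (List.mem_of_mem_take hi)), map_wire_take e,
        map_wire_append (fun i hi => by rw [hl]; exact (htpos i hi).trans_le (by omega)),
        map_wire_nandRun (fun i hi => by
          rw [List.length_append, hw]; exact (htpos i hi).trans_le (by omega)),
        map_wire_append (by rwa [hw]), hb]
      rfl
    · rw [List.map_append, map_wire_reply hl, map_wire_append
        (fun i hi => by rw [hl]; exact (hpos i hi).trans_le (by omega)),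
        map_wire_nandRun (fun i hi => by
          rw [List.length_append, hw]; exact (hpos i hi).trans_le (by omega)),
        map_wire_append (by rwa [hw])]

theorem exists_simulates_test {B M S : ℕ} {R : I.Rel} (C : LogicCircuit) (hC : C.size ≤ S)
    (hR : ∀ x y, C.eval (wordBits x ++ wordBits y) = [I.test R n x y]) (q : List ℕ)
    (hpos : ∀ i ∈ pos, i < N) (htpos : ∀ i ∈ tpos, i < N)
    (htl : tpos.length = t * (ℓ + (w + n)))
    (ih : ∀ N' pos', (∀ i ∈ pos', i < N') → (∀ i ∈ tpos, i < N') →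
      ∃ gs' out, (gs'.map Gate.cost).sum ≤ B ∧ out.length ≤ M ∧
        Simulates δ fin I gs N' pos' tpos t gs' out) :
    ∃ gs' out, (gs'.map Gate.cost).sum ≤ 1 + instrCost w ℓ n t (q.length * 2) S + B ∧
      out.length ≤ M ∧ Simulates δ fin I (.ask (.inl (.inr R)) q :: gs) N pos tpos t gs' out := by
  let α := {x : List Bool × List (BitVec ℓ × BitVec w × BitVec n) × Bool //
    x.1.length = pos.length ∧ x.2.1.length = t}
  have l1 : ∀ x : α, x.1.1.length = pos.length := fun x => x.2.1
  have l2 : ∀ x : α, (x.1.2.1.flatMap entryBits).length = t * (ℓ + (w + n)) := fun x =>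
    flatMap_length_const _ x.2.2
  have l3 : ∀ x : α, [x.1.2.2].length = 1 := fun x => rfl
  have l23 : ∀ x : α, (x.1.2.1.flatMap entryBits ++ [x.1.2.2]).length =
      t * (ℓ + (w + n)) + 1 := fun x => by rw [List.length_append, l2, l3]
  have p1 := Computes.left l1 l23
  have p2 := (Computes.right l1 l23).trans (Computes.left l2 l3)
  have p3 := (Computes.right l1 l23).trans (Computes.right l2 l3)
  have hq := (p1.trans (Computes.wires l1 q)).mono (t := q.length * 2) (by omega)
  obtain ⟨gs₀, out₀, h1, h2, -, h3⟩ := (Computes.testResult I C hC hR hq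
    (fun x => List.length_map _) p2 (fun x => x.2.2) p3).embed
      (N := N + 1) (ins := pos ++ (tpos ++ [N]))
      (by
        simp only [List.mem_append, List.mem_singleton]
        rintro i (hi | hi | hi)
        · exact (hpos i hi).trans_le (by omega)
        · exact (htpos i hi).trans_le (by omega)
        · omega)
      (by simp [htl])
  obtain ⟨gs₁, out, c1, c2, H⟩ := ih (N + 1 + gs₀.length) (pos ++ out₀)
    (by
      intro i hi
      rcases List.mem_append.1 hi with hi | hi
      · exact (hpos i hi).trans_le (by omega)
      · exact h2 i hi)
    fun i hi => (htpos i hi).trans_le (by omega)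
  refine ⟨.coin :: (gs₀.map (fun g => .nand g.1 g.2) ++ gs₁), out, ?_, c2, ?_⟩
  · simp only [List.map_append, List.sum_append, sum_cost_nand, Gate.cost, List.map_cons,
      List.sum_cons]
    omega
  · intro σ enc sel upd ws T s hw hT hb
    rw [runGates, runGates, tableOracle, PMF.bind_map, PMF.map_bind, PMF.map_bind]
    refine congrArg _ (funext fun u => ?_)
    have hN : [N].map (wire (ws ++ [u])) = [u] := by
      subst hw
      rw [List.map_singleton]
      congr 1
      exact wire_append_right ws [u] 0
    have e := h3 (ws ++ [u]) ⟨(pos.map (wire ws), T, u), by simp, hT⟩ (by simp [hw])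
      (by rw [List.map_append, List.map_append, map_wire_append (by rwa [hw]),
        map_wire_append (by rwa [hw]), hb, hN])
    rw [runGates_nand]
    refine H.step ?_ hT ?_ ?_
    · simp [length_nandRun, hw]
    · rw [map_wire_nandRun (fun i hi => by
          rw [List.length_append, hw]; exact (htpos i hi).trans_le (by omega)),
        map_wire_append (by rwa [hw]), hb]
    · rw [List.map_append, e, map_wire_nandRun (fun i hi => by
          rw [List.length_append, hw]; exact (hpos i hi).trans_le (by omega)),
        map_wire_append (by rwa [hw])]

/-- The plaintext `m` is hardwired, so the query consists of constants. The entry goes to the end of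
the table, which keeps the items in view in their original order. -/
theorem exists_simulates_encrypt {B M : ℕ} (m : BitVec w × BitVec n) (q : List ℕ)
    (hpos : ∀ i ∈ pos, i < N) (htpos : ∀ i ∈ tpos, i < N)
    (htl : tpos.length = t * (ℓ + (w + n)))
    (ih : ∀ N' pos' tpos', (∀ i ∈ pos', i < N') → (∀ i ∈ tpos', i < N') →
      tpos'.length = (t + 1) * (ℓ + (w + n)) →
      ∃ gs' out, (gs'.map Gate.cost).sum ≤ B ∧ out.length ≤ M ∧
        Simulates δ fin I gs N' pos' tpos' (t + 1) gs' out) :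
    ∃ gs' out, (gs'.map Gate.cost).sum ≤ 2 + (1 + 2 * (w + n)) + B ∧ out.length ≤ M ∧
      Simulates δ fin I (.ask (.inr m) q :: gs) N pos tpos t gs' out := by
  obtain ⟨gs₀, out₀, h1, h2, hl, h3⟩ := (Computes.const (α := Unit) (f := fun _ => []) (a := 0)
    (fun _ => rfl) (shiftQuery δ m)).embed (N := N) (ins := []) (by simp) rfl
  have hlen : out₀.length = 2 * (w + n) := by rw [hl (), length_shiftQuery]
  obtain ⟨gs₁, out, c1, c2, H⟩ := ih (N + gs₀.length + ℓ)
    (pos ++ List.range' (N + gs₀.length) ℓ)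
    (tpos ++ (List.range' (N + gs₀.length) ℓ ++ out₀.take (w + n)))
    (by
      simp only [List.mem_append, List.mem_range'_1]
      rintro i (hi | hi)
      · exact (hpos i hi).trans_le (by omega)
      · exact hi.2)
    (by
      simp only [List.mem_append, List.mem_range'_1]
      rintro i (hi | hi | hi)
      · exact (htpos i hi).trans_le (by omega)
      · exact hi.2
      · exact (h2 i (List.mem_of_mem_take hi)).trans_le (by omega))
    (by
      simp only [List.length_append, List.length_range', List.length_take, hlen, htl]
      rw [min_eq_left (by omega)]
      ring)
  refine ⟨gs₀.map (fun g => .nand g.1 g.2) ++ .ask () out₀ :: gs₁, out, ?_, c2, ?_⟩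
  · simp only [List.map_append, List.sum_append, sum_cost_nand, Gate.cost, List.map_cons,
      List.sum_cons, hlen]
    omega
  · intro σ enc sel upd ws T s hw hT hb
    have e := h3 ws () hw rfl
    have hl : (nandRun gs₀ ws).length = N + gs₀.length := by rw [length_nandRun, hw]
    rw [runGates_nand, runGates_ask_selOracle _ _ _ e, runGates, tableOracle, PMF.bind_map,
      PMF.map_bind, PMF.map_bind]
    refine congrArg _ (funext fun c => H.step ?_ ?_ ?_ ?_)
    · rw [List.length_append, hl, length_wordBits]
    · simp [hT]
    · rw [List.map_append, List.map_append, map_wire_reply hl, map_wire_append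
        (fun i hi => by rw [hl]; exact (htpos i hi).trans_le (by omega)), map_wire_append
        (fun i hi => by rw [hl]; exact h2 i (List.mem_of_mem_take hi)), map_wire_take e,
        map_wire_nandRun (by rwa [hw]), hb, List.flatMap_append, List.flatMap_singleton]
      rfl
    · rw [List.map_append, map_wire_reply hl, map_wire_append
        (fun i hi => by rw [hl]; exact (hpos i hi).trans_le (by omega)),
        map_wire_nandRun (by rwa [hw])]

theorem exists_simulates {F M S Tmax : ℕ} (hI : UnitsOfSize I n S)
    (hfin : FinalComputes w ℓ n Tmax F fin) (hM : ∀ v T, (fin v T).length ≤ M)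
    (gs : List (Gate ((I.Op ⊕ I.Rel) ⊕ (BitVec w × BitVec n))))
    (N : ℕ) (pos tpos : List ℕ) (t : ℕ) (hpos : ∀ i ∈ pos, i < N) (htpos : ∀ i ∈ tpos, i < N)
    (htl : tpos.length = t * (ℓ + (w + n))) (ht : t + gs.length ≤ Tmax) :
    ∃ gs' out, (gs'.map Gate.cost).sum ≤
        simFactor w ℓ n Tmax S * (gs.map Gate.cost).sum + F ∧ out.length ≤ M ∧
      Simulates δ fin I gs N pos tpos t gs' out := by
  induction gs generalizing N pos tpos t with
  | nil => simpa using exists_simulates_nil hfin hM hpos htpos htl ht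
  | cons g gs ih =>
    rw [List.length_cons] at ht
    simp only [List.map_cons, List.sum_cons, mul_add]
    -- Each gate pays for its own simulation: the factor `simFactor` times its cost covers the gates
    -- added for it.
    have weaken : ∀ {c : ℕ}, c ≤ simFactor w ℓ n Tmax S * g.cost →
        (∃ gs' out, (gs'.map Gate.cost).sum ≤
          c + (simFactor w ℓ n Tmax S * (gs.map Gate.cost).sum + F) ∧ out.length ≤ M ∧
            Simulates δ fin I (g :: gs) N pos tpos t gs' out) →
        ∃ gs' out, (gs'.map Gate.cost).sum ≤ simFactor w ℓ n Tmax S * g.cost +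
          simFactor w ℓ n Tmax S * (gs.map Gate.cost).sum + F ∧ out.length ≤ M ∧
            Simulates δ fin I (g :: gs) N pos tpos t gs' out := by
      rintro c hc ⟨gs', out, h1, h2⟩
      exact ⟨gs', out, by omega, h2⟩
    have hS : 40 ≤ simFactor w ℓ n Tmax S := by rw [simFactor]; omega
    have hask : ∀ q : List ℕ, simFactor w ℓ n Tmax S + q.length * 40 ≤
        simFactor w ℓ n Tmax S * (1 + q.length) := fun q => by
      have := Nat.mul_le_mul_left q.length hS
      rw [mul_add, mul_one, mul_comm _ q.length]
      omega
    have hmono : ∀ q : List ℕ, instrCost w ℓ n t (q.length * 2) S ≤ _ := fun q =>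
      instrCost_mono (show t ≤ Tmax by omega) _ S
    -- Splits the quadratic term so that `n * (n * 30 + 14)` appears as in the cost of
    -- `exists_simulates_op`, with the remaining `n` paying for the coins.
    have hsf : simFactor w ℓ n Tmax S = instrCost w ℓ n Tmax 0 S + (n * (n * 30 + 14) + n) +
        2 * (w + n) + 40 := by rw [simFactor]; ring
    cases g with
    | nand i j =>
      refine weaken ?_ (exists_simulates_nand i j hpos htpos fun N' pos' h1 h2 =>
        ih N' pos' tpos t h1 h2 htl (by omega))
      simp only [Gate.cost]
      omega
    | coin =>
      refine weaken ?_ (exists_simulates_coin hpos htpos fun N' pos' h1 h2 =>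
        ih N' pos' tpos t h1 h2 htl (by omega))
      simp only [Gate.cost]
      omega
    | ask k q =>
      have h1 := hask q
      have h2 := hmono q
      rcases k with (θ | R) | m
      · obtain ⟨C, hC, hθ⟩ := hI.1 θ
        refine weaken ?_ (exists_simulates_op C hC hθ q hpos htpos htl
          fun N' pos' tpos' h1 h2 h3 => ih N' pos' tpos' _ h1 h2 h3 (by omega))
        simp only [Gate.cost]
        omega
      · obtain ⟨C, hC, hR⟩ := hI.2 R
        refine weaken ?_ (exists_simulates_test C hC hR q hpos htpos htl
          fun N' pos' h1 h2 => ih N' pos' tpos _ h1 h2 htl (by omega))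
        simp only [Gate.cost]
        omega
      · refine weaken ?_ (exists_simulates_encrypt m q hpos htpos htl
          fun N' pos' tpos' h1 h2 h3 => ih N' pos' tpos' _ h1 h2 h3 (by omega))
        simp only [Gate.cost]
        omega

end Simulation

/-! ### The restricted platform computes on a table -/

theorem PMF.bind_congr_support {α β : Type} {p : PMF α} {f g : α → PMF β}
    (h : ∀ a ∈ p.support, f a = g a) : p.bind f = p.bind g := by
  ext b
  simp only [PMF.bind_apply]
  refine tsum_congr fun a => ?_
  by_cases ha : a ∈ p.support
  · rw [h a ha]
  · rw [(PMF.apply_eq_zero_iff p a).2 ha, zero_mul, zero_mul]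

/-- Renames the oracles of a gate. -/
def Gate.relabel {κ κ' : Type} (ρ : κ → κ') : Gate κ → Gate κ'
  | .nand i j => .nand i j
  | .coin => .coin
  | .ask k q => .ask (ρ k) q

theorem Gate.cost_relabel {κ κ' : Type} (ρ : κ → κ') (g : Gate κ) :
    (g.relabel ρ).cost = g.cost := by
  cases g <;> rfl

/-! ### Transfer between oracles, and invariants of oracle runs. -/

section Invariant

variable {κ κ' σ τ : Type} {O' : κ → List Bool → σ → PMF (List Bool × σ)}
  {O : κ' → List Bool → τ → PMF (List Bool × τ)} {ρ : κ → κ'} {f : τ → σ} {Inv : τ → Prop}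

/-- A state map that intertwines the two oracles on states satisfying an invariant intertwines whole
runs. -/
theorem runGates_relabel
    (h1 : ∀ k q t, Inv t → O' k q (f t) = (O (ρ k) q t).map (Prod.map id f))
    (h2 : ∀ k q t, Inv t → ∀ r ∈ (O (ρ k) q t).support, Inv r.2)
    (gs : List (Gate κ)) (ws : List Bool) (t : τ) (ht : Inv t) :
    runGates O' gs ws (f t) =
      (runGates O (gs.map (Gate.relabel ρ)) ws t).map (Prod.map id f) := by
  induction gs generalizing ws t with
  | nil => simp [runGates, PMF.pure_map]
  | cons g gs ih =>
    cases g with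
    | nand i j => exact ih _ t ht
    | coin =>
      rw [runGates, List.map_cons, Gate.relabel, runGates, PMF.map_bind]
      exact congrArg _ (funext fun b => ih _ t ht)
    | ask k q =>
      rw [runGates, List.map_cons, Gate.relabel, runGates, PMF.map_bind, h1 _ _ _ ht,
        PMF.bind_map]
      exact PMF.bind_congr_support fun r hr => ih _ _ (h2 _ _ _ ht r hr)

theorem runGates_invariant (h : ∀ k q t, Inv t → ∀ r ∈ (O k q t).support, Inv r.2)
    (gs : List (Gate κ')) (ws : List Bool) (t : τ) (ht : Inv t) :
    ∀ r ∈ (runGates O gs ws t).support, Inv r.2 := by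
  induction gs generalizing ws t with
  | nil => simpa [runGates] using ht
  | cons g gs ih =>
    cases g with
    | nand i j => exact ih _ t ht
    | coin =>
      intro r hr
      rw [runGates, PMF.mem_support_bind_iff] at hr
      obtain ⟨b, -, hr⟩ := hr
      exact ih _ t ht r hr
    | ask k q =>
      intro r hr
      rw [runGates, PMF.mem_support_bind_iff] at hr
      obtain ⟨b, hb, hr⟩ := hr
      exact ih _ _ (h _ _ _ ht b hb) r hr

end Invariant

section Lookup

variable {n ℓ : ℕ} {g : BitVec w} {c : BitVec ℓ}

theorem lookup_eq_some {T : List (BitVec ℓ × BitVec w × BitVec n)} {x : BitVec n}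
    (h : lookup g c T = some x) : (c, g, x) ∈ T := by
  induction T with
  | nil => simp [lookup] at h
  | cons e T ih =>
    rw [lookup] at h
    split_ifs at h with he
    · obtain ⟨rfl, rfl⟩ := he
      simp at h
      simp [← h]
    · exact List.mem_cons_of_mem _ (ih h)

theorem lookup_eq_none {T : List (BitVec ℓ × BitVec w × BitVec n)}
    (h : lookup g c T = none) (x : BitVec n) : (c, g, x) ∉ T := by
  induction T with
  | nil => simp
  | cons e T ih =>
    rw [lookup] at h
    split_ifs at h with he
    rw [List.mem_cons, not_or]
    refine ⟨?_, ih h⟩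
    rintro rfl
    exact he ⟨rfl, rfl⟩

end Lookup

section Observed

variable (E : Encryption w) (I : InstructionSet w) {n : ℕ} (k : E.Key n) (δ : BitVec n)

/-- The ciphertexts of a table decrypt to the shifts of the plaintexts recorded with them. -/
def Encryption.Decrypts (T : List (BitVec (E.ctLen n) × BitVec w × BitVec n)) : Prop :=
  ∀ e ∈ T, E.dec n k e.1 = some (shift δ e.2)

variable {E k δ}

/-- Entries with the same ciphertext decrypt to the same plaintext, so the first match in the table
is the right one. If no entry carries the wanted tag, an issued ciphertext decrypts to a plaintext
with another tag and is rejected. -/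
theorem contentOf_observed {T : List (BitVec (E.ctLen n) × BitVec w × BitVec n)}
    (hT : E.Decrypts k δ T) (κ : WordKind I.Op I.Rel) (c : BitVec (E.ctLen n)) :
    contentOf E I n k .observed (T.map Prod.fst) κ c =
      (lookup (I.tag κ) c T).map fun x => x + δ := by
  rw [contentOf, plainOf]
  cases h : lookup (I.tag κ) c T with
  | some x =>
    have h1 := lookup_eq_some h
    rw [if_pos (List.mem_map_of_mem (f := Prod.fst) h1), hT _ h1]
    simp [shift]
  | none =>
    split_ifs with hc
    · obtain ⟨⟨c', g, x⟩, he, rfl⟩ := List.mem_map.1 hc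
      rw [hT _ he]
      simp only [shift, Option.bind_some, Option.map_none, ite_eq_right_iff, reduceCtorEq,
        imp_false]
      rintro rfl
      exact lookup_eq_none h x he
    · rfl

theorem map_add_uniformOfFintype (δ : BitVec n) :
    (PMF.uniformOfFintype (BitVec n)).map (fun u => u + δ) = PMF.uniformOfFintype (BitVec n) :=
  map_uniformOfFintype_equiv (Equiv.addRight δ)

/-- The equivariance of the processor. In `x - k` the shifts cancel, so tests are unchanged and the
result of an operation inherits one shift from `k₀`; nonsense is unaffected because a uniform word
plus `δ` is uniform. -/
theorem platform_observed {σ : Type} (upd : σ → BitVec (E.ctLen n) → σ)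
    {T : List (BitVec (E.ctLen n) × BitVec w × BitVec n)} (hT : E.Decrypts k δ T) (s : σ)
    (κ : I.Op ⊕ I.Rel) (q : List Bool) :
    platform E I n k .observed κ q (T.map Prod.fst) =
      (tableOracle I (fun m => E.enc n k (shift δ m)) upd (.inl κ) q (T, s)).map
        (Prod.map id fun t => t.1.map Prod.fst) := by
  rcases κ with θ | R
  · have key : ∀ o₀ o₁ o₂ o₃ o₄ : Option (BitVec n),
        (match o₀.map (· + δ), o₁.map (· + δ), o₂.map (· + δ), o₃.map (· + δ), o₄.map (· + δ) with
        | some k₀, some k₁, some k₂, some x₁, some x₂ =>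
            PMF.pure (I.eval θ n (x₁ - k₁) (x₂ - k₂) + k₀)
        | _, _, _, _, _ => PMF.uniformOfFintype (BitVec n)) =
        (PMF.uniformOfFintype (BitVec n)).map fun u =>
          (if o₀.isSome && o₁.isSome && o₂.isSome && o₃.isSome && o₄.isSome then
            I.eval θ n (o₃.getD 0 - o₁.getD 0) (o₄.getD 0 - o₂.getD 0) + o₀.getD 0
          else u) + δ := by
      intro o₀ o₁ o₂ o₃ o₄
      have hu := (map_add_uniformOfFintype (n := n) δ).symm
      rcases o₀ with _ | k₀
      · simpa using hu
      rcases o₁ with _ | k₁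
      · simpa using hu
      rcases o₂ with _ | k₂
      · simpa using hu
      rcases o₃ with _ | x₁
      · simpa using hu
      rcases o₄ with _ | x₂
      · simpa using hu
      simp only [Option.map_some, Option.isSome_some, Bool.and_self, if_true, Option.getD_some,
        add_sub_add_right_eq_sub, add_assoc]
      exact (PMF.map_const _ _).symm
    rw [platform, tableOracle, PMF.map_bind]
    simp only [contentOf_observed I hT]
    refine (congrArg (fun p => PMF.bind p _) (key _ _ _ _ _)).trans ?_
    rw [PMF.bind_map]
    refine congrArg _ (funext fun u => ?_)
    rw [PMF.map_comp]
    rfl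
  · have key : ∀ o₁ o₂ o₃ o₄ : Option (BitVec n),
        (match o₁.map (· + δ), o₂.map (· + δ), o₃.map (· + δ), o₄.map (· + δ) with
        | some k₁, some k₂, some x₁, some x₂ => PMF.pure (I.test R n (x₁ - k₁) (x₂ - k₂))
        | _, _, _, _ => PMF.uniformOfFintype Bool) =
        (PMF.uniformOfFintype Bool).map fun u =>
          if o₁.isSome && o₂.isSome && o₃.isSome && o₄.isSome then
            I.test R n (o₃.getD 0 - o₁.getD 0) (o₄.getD 0 - o₂.getD 0)
          else u := by
      intro o₁ o₂ o₃ o₄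
      have hu : _ = (PMF.uniformOfFintype Bool).map fun u => u := (PMF.map_id _).symm
      rcases o₁ with _ | k₁
      · simpa using hu
      rcases o₂ with _ | k₂
      · simpa using hu
      rcases o₃ with _ | x₁
      · simpa using hu
      rcases o₄ with _ | x₂
      · simpa using hu
      simp only [Option.map_some, Option.isSome_some, Bool.and_self, if_true, Option.getD_some,
        add_sub_add_right_eq_sub]
      exact (PMF.map_const _ _).symm
    rw [platform, tableOracle]
    simp only [contentOf_observed I hT]
    refine (congrArg (PMF.map _) (key _ _ _ _)).trans ?_
    rw [PMF.map_comp, PMF.map_comp]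
    rfl

theorem decrypts_tableOracle (hk : k ∈ (E.gen n).support) {σ : Type}
    (upd : σ → BitVec (E.ctLen n) → σ) (κ : (I.Op ⊕ I.Rel) ⊕ (BitVec w × BitVec n))
    (q : List Bool) (t : List (BitVec (E.ctLen n) × BitVec w × BitVec n) × σ)
    (ht : E.Decrypts k δ t.1) :
    ∀ r ∈ (tableOracle I (fun m => E.enc n k (shift δ m)) upd κ q t).support,
      E.Decrypts k δ r.2.1 := by
  intro r hr
  rcases κ with (θ | R) | m
  · simp only [tableOracle, PMF.mem_support_bind_iff, PMF.mem_support_map_iff] at hr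
    obtain ⟨u, -, c, hc, rfl⟩ := hr
    intro e he
    rcases List.mem_cons.1 he with rfl | he
    · exact E.correct _ _ _ _ hk hc
    · exact ht e he
  · simp only [tableOracle, PMF.mem_support_map_iff] at hr
    obtain ⟨u, -, rfl⟩ := hr
    exact ht
  · simp only [tableOracle, PMF.mem_support_map_iff] at hr
    obtain ⟨c, hc, rfl⟩ := hr
    intro e he
    rcases List.mem_append.1 he with he | he
    · exact ht e he
    · rw [List.mem_singleton.1 he]
      exact E.correct _ _ _ _ hk hc

/-- The issued ciphertexts are those of the table. -/
theorem issued_tableOracle {ℓ : ℕ} (e : BitVec w × BitVec n → PMF (BitVec ℓ))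
    (κ : (I.Op ⊕ I.Rel) ⊕ (BitVec w × BitVec n)) (q : List Bool)
    (t : List (BitVec ℓ × BitVec w × BitVec n) × List (BitVec ℓ))
    (ht : ∀ c, c ∈ t.2 ↔ c ∈ t.1.map Prod.fst) :
    ∀ r ∈ (tableOracle I e (fun s c => c :: s) κ q t).support,
      ∀ c, c ∈ r.2.2 ↔ c ∈ r.2.1.map Prod.fst := by
  intro r hr
  rcases κ with (θ | R) | m
  · simp only [tableOracle, PMF.mem_support_bind_iff, PMF.mem_support_map_iff] at hr
    obtain ⟨u, -, c, hc, rfl⟩ := hr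
    intro c'
    simp only [List.mem_cons, List.map_cons, ht]
  · simp only [tableOracle, PMF.mem_support_map_iff] at hr
    obtain ⟨u, -, rfl⟩ := hr
    exact ht
  · simp only [tableOracle, PMF.mem_support_map_iff] at hr
    obtain ⟨c, hc, rfl⟩ := hr
    intro c'
    simp only [List.mem_cons, List.map_append, List.mem_append, ht, List.map_cons, List.map_nil,
      List.not_mem_nil, or_false]
    tauto

/-- Requests to encrypt the given plaintexts. -/
def encryptGates (I : InstructionSet w) (ms : List (BitVec w × BitVec n)) :
    List (Gate ((I.Op ⊕ I.Rel) ⊕ (BitVec w × BitVec n))) :=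
  ms.map fun m => .ask (.inr m) []

theorem runGates_encryptGates {σ : Type} (upd : σ → BitVec (E.ctLen n) → σ)
    (ms : List (BitVec w × BitVec n)) (ws : List Bool)
    (t : List (BitVec (E.ctLen n) × BitVec w × BitVec n) × σ) :
    (runGates (tableOracle I (fun m => E.enc n k (shift δ m)) upd) (encryptGates I ms) ws t).map
        (Prod.map id fun t => t.1.map Prod.fst) =
      (encryptAll E n k (ms.map (shift δ))).map fun cs =>
        (ws ++ cs.flatMap wordBits, t.1.map Prod.fst ++ cs) := by
  induction ms generalizing ws t with
  | nil => simp [encryptGates, runGates, encryptAll, PMF.pure_map]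
  | cons m ms ih =>
    rw [encryptGates, List.map_cons, runGates, tableOracle, PMF.bind_map, List.map_cons,
      encryptAll, PMF.map_bind, PMF.map_bind]
    refine congrArg _ (funext fun c => ?_)
    rw [PMF.map_comp]
    refine (ih _ _).trans ?_
    congr 1
    funext cs
    simp

/-- The requests of the game: the items in view are encrypted, then the operator runs. -/
def gameGates (I : InstructionSet w) (ms : List (BitVec w × BitVec n))
    (gs : List (Gate (I.Op ⊕ I.Rel))) : List (Gate ((I.Op ⊕ I.Rel) ⊕ (BitVec w × BitVec n))) :=
  encryptGates I ms ++ gs.map (Gate.relabel Sum.inl)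

/-- The restricted game on shifted plaintexts is a run of the table oracle on the unshifted ones;
decryption has disappeared. The extra state `σ` remains free, so that it can be trivial for IND-CPA
and the list of issued ciphertexts for INT-CTXT. -/
theorem run_observed (hk : k ∈ (E.gen n).support) {σ : Type}
    (upd : σ → BitVec (E.ctLen n) → σ) (s : σ) (ms : List (BitVec w × BitVec n))
    (C : OracleCircuit (I.Op ⊕ I.Rel)) :
    ((encryptAll E n k (ms.map (shift δ))).bind fun cs =>
        C.run (platform E I n k .observed) (cs.flatMap wordBits) cs) =
      (runGates (tableOracle I (fun m => E.enc n k (shift δ m)) upd) (gameGates I ms C.gates) []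
        ([], s)).map fun r => (C.out.map (wire r.1), r.2.1.map Prod.fst) := by
  have h1 := runGates_encryptGates (k := k) (δ := δ) I upd ms [] ([], s)
  simp only [List.nil_append, List.map_nil] at h1
  rw [gameGates, runGates_append, PMF.map_bind]
  have h2 : ∀ F : List Bool × List (BitVec (E.ctLen n)) → PMF (List Bool × List (BitVec (E.ctLen n))),
      ((encryptAll E n k (ms.map (shift δ))).bind fun cs => F (cs.flatMap wordBits, cs)) =
        ((encryptAll E n k (ms.map (shift δ))).map fun cs => (cs.flatMap wordBits, cs)).bind F :=
    fun F => by rw [PMF.bind_map]; rfl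
  rw [h2 fun p => C.run (platform E I n k .observed) p.1 p.2, ← h1, PMF.bind_map]
  refine PMF.bind_congr_support fun r hr => ?_
  have hr' : E.Decrypts k δ r.2.1 :=
    runGates_invariant (Inv := fun t => E.Decrypts k δ t.1)
      (decrypts_tableOracle I hk upd) _ _ ([], s) (by simp [Encryption.Decrypts]) r hr
  have h3 := runGates_relabel (O' := platform E I n k .observed) (ρ := Sum.inl)
    (f := fun t : List (BitVec (E.ctLen n) × BitVec w × BitVec n) × σ => t.1.map Prod.fst)
    (Inv := fun t => E.Decrypts k δ t.1)
    (fun κ q t ht => platform_observed I upd ht t.2 κ q)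
    (fun κ => decrypts_tableOracle I hk upd (.inl κ)) C.gates r.1 r.2 hr'
  simp only [Function.comp_apply, Prod.map_fst, Prod.map_snd, id_eq, OracleCircuit.run]
  rw [h3, PMF.map_comp]
  rfl

end Observed

/-! ### Probabilities -/

section Probability

open scoped ENNReal

variable {α β γ : Type}

theorem PMF.toOuterMeasure_le_one (p : PMF α) (S : Set α) : p.toOuterMeasure S ≤ 1 := by
  rw [PMF.toOuterMeasure_apply, ← p.tsum_coe]
  exact ENNReal.tsum_le_tsum fun a => Set.indicator_le_self _ _ _

theorem ofReal_prob (p : PMF α) (S : Set α) : ENNReal.ofReal (prob p S) = p.toOuterMeasure S :=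
  ENNReal.ofReal_toReal (ne_top_of_le_ne_top ENNReal.one_ne_top (p.toOuterMeasure_le_one S))

theorem prob_nonneg (p : PMF α) (S : Set α) : 0 ≤ prob p S := ENNReal.toReal_nonneg

theorem prob_le {p : PMF α} {S : Set α} {x : ℝ} (hx : 0 ≤ x)
    (h : p.toOuterMeasure S ≤ ENNReal.ofReal x) : prob p S ≤ x :=
  ENNReal.toReal_le_of_le_ofReal hx h

theorem PMF.toOuterMeasure_bind_le_add_sum {p : PMF α} {f : α → PMF β} {g : α → PMF γ}
    {ι : Type} {J : Finset ι} {δ : ι → Type} {h : ∀ i, α → PMF (δ i)} {S : Set β} {S' : Set γ}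
    {U : ∀ i, Set (δ i)}
    (H : ∀ a ∈ p.support, (f a).toOuterMeasure S ≤
      (g a).toOuterMeasure S' + ∑ i ∈ J, (h i a).toOuterMeasure (U i)) :
    (p.bind f).toOuterMeasure S ≤
      (p.bind g).toOuterMeasure S' + ∑ i ∈ J, (p.bind (h i)).toOuterMeasure (U i) := by
  simp only [PMF.toOuterMeasure_bind_apply]
  rw [← Summable.tsum_finsetSum fun _ _ => ENNReal.summable, ← ENNReal.tsum_add]
  refine ENNReal.tsum_le_tsum fun a => ?_
  rw [← Finset.mul_sum, ← mul_add]
  by_cases ha : a ∈ p.support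
  · exact mul_le_mul_right (H a ha) _
  · rw [(PMF.apply_eq_zero_iff p a).2 ha, zero_mul]
    exact zero_le

theorem PMF.toOuterMeasure_bind_le_add {p : PMF α} {f : α → PMF β} {g : α → PMF γ}
    {S : Set β} {S' : Set γ} {ε : ℝ≥0∞}
    (H : ∀ a ∈ p.support, (f a).toOuterMeasure S ≤ (g a).toOuterMeasure S' + ε) :
    (p.bind f).toOuterMeasure S ≤ (p.bind g).toOuterMeasure S' + ε := by
  have h1 : ε = ∑' a, p a * ε := by rw [ENNReal.tsum_mul_right, p.tsum_coe, one_mul]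
  simp only [PMF.toOuterMeasure_bind_apply]
  conv_rhs => rw [h1]
  rw [← ENNReal.tsum_add]
  refine ENNReal.tsum_le_tsum fun a => ?_
  rw [← mul_add]
  by_cases ha : a ∈ p.support
  · exact mul_le_mul_right (H a ha) _
  · rw [(PMF.apply_eq_zero_iff p a).2 ha, zero_mul]
    exact zero_le

theorem PMF.toOuterMeasure_bind_le {p : PMF α} {f : α → PMF β} {S : Set β} {ε : ℝ≥0∞}
    (H : ∀ a ∈ p.support, (f a).toOuterMeasure S ≤ ε) : (p.bind f).toOuterMeasure S ≤ ε := by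
  have := PMF.toOuterMeasure_bind_le_add (p := p) (f := f) (g := fun _ => PMF.pure ()) (S := S)
    (S' := ∅) (ε := ε) (fun a ha => by simpa using H a ha)
  simpa using this

theorem PMF.toOuterMeasure_bind_mono {p : PMF α} {f : α → PMF β} {g : α → PMF γ}
    {S : Set β} {S' : Set γ}
    (H : ∀ a ∈ p.support, (f a).toOuterMeasure S ≤ (g a).toOuterMeasure S') :
    (p.bind f).toOuterMeasure S ≤ (p.bind g).toOuterMeasure S' := by
  simpa using PMF.toOuterMeasure_bind_le_add (ε := 0) (by simpa using H)

theorem PMF.toOuterMeasure_map_mono {p : PMF α} {f : α → β} {g : α → γ} {S : Set β} {S' : Set γ}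
    (H : ∀ a ∈ p.support, f a ∈ S → g a ∈ S') :
    (p.map f).toOuterMeasure S ≤ (p.map g).toOuterMeasure S' := by
  rw [PMF.toOuterMeasure_map_apply, PMF.toOuterMeasure_map_apply]
  exact p.toOuterMeasure_mono fun a ha => H a ha.2 ha.1

theorem toOuterMeasure_uniformOfFintype_le [Fintype α] [Nonempty α] {S : Set α}
    [DecidablePred (· ∈ S)] {c : ℕ}
    (h : (Finset.univ.filter (· ∈ S)).card ≤ c) :
    (PMF.uniformOfFintype α).toOuterMeasure S ≤ c / Fintype.card α := by
  rw [PMF.toOuterMeasure_uniformOfFintype_apply, Fintype.card_subtype]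
  gcongr

end Probability

/-! ### Oracles that agree until a bad query -/

section UntilBad

open scoped ENNReal

variable {κ σ : Type} {O₁ O₂ : κ → List Bool → σ → PMF (List Bool × σ)}
  {Bad : κ → List Bool → σ → Prop}

/-- The event that gate `i` asks a bad query. -/
def badAt (Bad : κ → List Bool → σ → Prop) (gs : List (Gate κ)) (i : ℕ) :
    Set (List Bool × σ) :=
  {r | ∃ k q, gs[i]? = some (.ask k q) ∧ Bad k (q.map (wire r.1)) r.2}

/-- The error is charged entirely to runs of `O₂`, stopped just before gate `i`. This lets the
forger simulate only the restricted platform. -/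
theorem runGates_until_bad (h : ∀ k q s, ¬ Bad k q s → O₁ k q s = O₂ k q s)
    (gs : List (Gate κ)) (ws : List Bool) (s : σ) (S : Set (List Bool × σ)) :
    (runGates O₁ gs ws s).toOuterMeasure S ≤ (runGates O₂ gs ws s).toOuterMeasure S +
      ∑ i ∈ Finset.range gs.length,
        (runGates O₂ (gs.take i) ws s).toOuterMeasure (badAt Bad gs i) := by
  induction gs generalizing ws s with
  | nil => simp [runGates]
  | cons g gs ih =>
    have hbad : ∀ i, badAt Bad (g :: gs) (i + 1) = badAt Bad gs i := fun i => by simp [badAt]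
    rw [List.length_cons, Finset.sum_range_succ', ← add_assoc]
    simp only [List.take_succ_cons, hbad, List.take_zero]
    cases g with
    | nand i j => exact (ih _ s).trans le_self_add
    | coin => exact (PMF.toOuterMeasure_bind_le_add_sum fun b _ => ih _ s).trans le_self_add
    | ask k q =>
      by_cases hb : Bad k (q.map (wire ws)) s
      -- If the first query is already bad, the term for gate `0` equals `1` and dominates.
      · refine (PMF.toOuterMeasure_le_one _ _).trans (le_add_left ?_)
        rw [runGates, PMF.toOuterMeasure_pure_apply, if_pos ⟨k, q, rfl, hb⟩]
      · have e : runGates O₁ (.ask k q :: gs) ws s =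
            (O₂ k (q.map (wire ws)) s).bind fun r => runGates O₁ gs (ws ++ r.1) r.2 := by
          rw [runGates, h _ _ _ hb]
        rw [e]
        exact (PMF.toOuterMeasure_bind_le_add_sum fun r _ => ih _ r.2).trans le_self_add

end UntilBad

/-! ### Counting bounds for a uniform offset. -/

section Chance

variable {n : ℕ}

theorem chance_nonneg (φ : BitVec n → List Bool) : 0 ≤ chance φ := by
  unfold chance
  positivity

theorem card_bitVec (n : ℕ) : Fintype.card (BitVec n) = 2 ^ n := by
  rw [Fintype.card_congr (BitVec.equivFin (m := n)).toEquiv, Fintype.card_fin]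

/-- Translation by `x` is injective and maps the event into a single fibre of `φ`. -/
theorem uniform_attribute_le (φ : BitVec n → List Bool) (x : BitVec n) (l : List Bool) :
    (PMF.uniformOfFintype (BitVec n)).toOuterMeasure {δ | l = φ (x + δ)} ≤
      ENNReal.ofReal (chance φ) := by
  classical
  have h : (Finset.univ.filter (· ∈ {δ | l = φ (x + δ)})).card ≤
      Finset.univ.sup fun y : BitVec n => (Finset.univ.filter fun x => φ x = φ y).card := by
    by_cases hl : ∃ δ₀, l = φ (x + δ₀)
    · obtain ⟨δ₀, rfl⟩ := hl
      refine le_trans ?_ (Finset.le_sup (Finset.mem_univ (x + δ₀)))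
      refine Finset.card_le_card_of_injOn (fun δ => x + δ) ?_ fun a _ b _ hab => ?_
      · intro δ hδ
        simp only [Finset.coe_filter, Finset.mem_univ, true_and, Set.mem_ofPred_eq] at hδ ⊢
        exact hδ.symm
      · exact add_left_cancel hab
    · have h0 : Finset.univ.filter (· ∈ {δ | l = φ (x + δ)}) = ∅ :=
        Finset.filter_eq_empty_iff.2 fun δ _ hδ => hl ⟨δ, hδ⟩
      rw [h0]
      simp
  refine (toOuterMeasure_uniformOfFintype_le h).trans_eq ?_
  rw [chance, ENNReal.ofReal_div_of_pos (by positivity), card_bitVec]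
  congr 1
  · exact (ENNReal.ofReal_natCast _).symm
  · rw [ENNReal.ofReal_pow (by norm_num)]
    simp

theorem uniform_shift_le (o : Option (BitVec n)) (y : BitVec n) :
    (PMF.uniformOfFintype (BitVec n)).toOuterMeasure {δ | (o.map fun x => x + δ) = some y} ≤
      ENNReal.ofReal (1 / 2 ^ n) := by
  classical
  have h : (Finset.univ.filter (· ∈ {δ | (o.map fun x => x + δ) = some y})).card ≤ 1 := by
    rw [Finset.card_le_one]
    intro a ha b hb
    cases o with
    | none => simp at ha
    | some x =>
      simp only [Option.map_some, Set.mem_ofPred_eq, Option.some.injEq, Finset.mem_filter,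
        Finset.mem_univ, true_and] at ha hb
      exact add_left_cancel (ha.trans hb.symm)
  refine (toOuterMeasure_uniformOfFintype_le h).trans_eq ?_
  rw [ENNReal.ofReal_div_of_pos (by positivity), card_bitVec, ENNReal.ofReal_pow (by norm_num)]
  simp

end Chance

/-! ### Shifting an obfuscation scheme -/

namespace Program

variable {I : InstructionSet w} {n : ℕ} (P : Program I n)

/-- Adds an offset to all the offsets of a scheme. -/
def shiftScheme (D : P.Scheme) (δ : BitVec n) : P.Scheme := fun a l => D a l + δ

variable {P}

theorem Consistent.shift {D : P.Scheme} (hD : P.Consistent D) (δ : BitVec n) :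
    P.Consistent (P.shiftScheme D δ) := by
  intro a
  have h := hD a
  unfold Respects at h ⊢
  have e : ∀ b c, D b = D c → P.shiftScheme D δ b = P.shiftScheme D δ c := fun b c hbc => by
    funext l
    simp only [shiftScheme, hbc]
  have e' : ∀ b c l l', D b l = D c l' → P.shiftScheme D δ b l = P.shiftScheme D δ c l' :=
    fun b c l l' hbc => by simp only [shiftScheme, hbc]
  split at h
  · exact fun l hl => e' _ _ _ _ (h l hl)
  · exact ⟨e' _ _ _ _ h.1, fun l hl => e' _ _ _ _ (h.2 l hl)⟩
  · exact ⟨e _ _ h.1, e _ _ h.2⟩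
  · exact e _ _ h

/-- For each fixed `δ` the shift permutes the consistent schemes, with inverse the shift by `-δ`,
and so preserves the uniform distribution; averaging over `δ` changes nothing. -/
theorem randomScheme_bind_shift {β : Type} (F : P.Scheme → PMF β) :
    (P.randomScheme.bind fun D => F D.1) =
      (PMF.uniformOfFintype (BitVec n)).bind fun δ =>
        P.randomScheme.bind fun D => F (P.shiftScheme D.1 δ) := by
  have h : ∀ δ, (P.randomScheme.bind fun D => F (P.shiftScheme D.1 δ)) =
      P.randomScheme.bind fun D => F D.1 := fun δ => by
    let e : {D : P.Scheme // P.Consistent D} ≃ {D : P.Scheme // P.Consistent D} :=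
      { toFun := fun D => ⟨P.shiftScheme D.1 δ, D.2.shift δ⟩
        invFun := fun D => ⟨P.shiftScheme D.1 (-δ), D.2.shift (-δ)⟩
        left_inv := fun D => Subtype.ext (funext fun a => funext fun l => by simp [shiftScheme])
        right_inv := fun D =>
          Subtype.ext (funext fun a => funext fun l => by simp [shiftScheme]) }
    classical
    have he : P.randomScheme.map e = P.randomScheme := map_uniformOfFintype_equiv e
    conv_rhs => rw [← he, PMF.bind_map]
    rfl
  simp only [h, PMF.bind_const]

theorem itemPlains_shift (D : P.Scheme) (d : Fin P.locs → BitVec n) (δ : BitVec n)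
    (x : Fin P.locs ⊕ Fin P.len) :
    P.itemPlains (P.shiftScheme D δ) d x = (P.itemPlains D d x).map (_root_.shift δ) := by
  rcases x with l | a
  · simp [itemPlains, compileInput, shiftScheme, _root_.shift, add_assoc]
  · simp only [itemPlains, compile]
    split <;> simp [ObjInstr.constants, shiftScheme, _root_.shift, add_assoc]

/-- The compiled run for either scheme follows the nominal control flow, so at time `t` both are at
the same program point, where their offsets differ by `δ`. -/
theorem compiledRun_shift {D : P.Scheme} (hD : P.Consistent D) (d : Fin P.locs → BitVec n)
    (δ : BitVec n) (t : ℕ) (r : Fin P.locs) :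
    (P.compiledRun (P.shiftScheme D δ) d t).store r = (P.compiledRun D d t).store r + δ := by
  rw [compiledRun_eq P hD, compiledRun_eq P (hD.shift δ)]
  simp [shiftScheme, add_assoc]

theorem length_itemPlains (D : P.Scheme) (d : Fin P.locs → BitVec n)
    (x : Fin P.locs ⊕ Fin P.len) : (P.itemPlains D d x).length ≤ 3 := by
  rcases x with l | a
  · simp [itemPlains]
  · simp only [itemPlains, compile]
    split <;> simp [ObjInstr.constants]

end Program

/-! ### Polynomial bounds -/

namespace PolyBounded

variable {f g : ℕ → ℕ}

theorem mono (hg : PolyBounded g) (h : ∀ n, f n ≤ g n) : PolyBounded f := by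
  obtain ⟨p, hp⟩ := hg
  exact ⟨p, fun n => (h n).trans (hp n)⟩

theorem const (c : ℕ) : PolyBounded fun _ => c := ⟨Polynomial.C c, fun n => by simp⟩

theorem id : PolyBounded fun n => n := ⟨Polynomial.X, fun n => by simp⟩

theorem add (hf : PolyBounded f) (hg : PolyBounded g) : PolyBounded fun n => f n + g n := by
  obtain ⟨p, hp⟩ := hf
  obtain ⟨q, hq⟩ := hg
  exact ⟨p + q, fun n => by rw [Polynomial.eval_add]; exact add_le_add (hp n) (hq n)⟩

theorem mul (hf : PolyBounded f) (hg : PolyBounded g) : PolyBounded fun n => f n * g n := by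
  obtain ⟨p, hp⟩ := hf
  obtain ⟨q, hq⟩ := hg
  exact ⟨p * q, fun n => by rw [Polynomial.eval_mul]; exact Nat.mul_le_mul (hp n) (hq n)⟩

theorem sum {ι : Type*} (s : Finset ι) {f : ι → ℕ → ℕ} (h : ∀ i ∈ s, PolyBounded (f i)) :
    PolyBounded fun n => ∑ i ∈ s, f i n := by
  classical
  induction s using Finset.induction_on with
  | empty => simpa using const 0
  | insert i s hi ih =>
    simp only [Finset.sum_insert hi]
    exact (h i (Finset.mem_insert_self i s)).add
      (ih fun j hj => h j (Finset.mem_insert_of_mem hj))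

theorem lookupCost {ℓ t : ℕ → ℕ} (hℓ : PolyBounded ℓ) (ht : PolyBounded t) :
    PolyBounded fun n => lookupCost w (ℓ n) n (t n) := by
  unfold _root_.lookupCost
  exact (ht.mul ((((hℓ.mul (const 14)).add (const (w * 14))).add (id.mul (const 22))).add
    (const 40))).add (const 2)

theorem simFactor {ℓ t S : ℕ → ℕ} (hℓ : PolyBounded ℓ) (ht : PolyBounded t)
    (hS : PolyBounded S) : PolyBounded fun n => simFactor w (ℓ n) n (t n) (S n) := by
  unfold _root_.simFactor instrCost
  exact (((((((const 10).mul (((const 0).add (hℓ.mul (const 2))).add (lookupCost hℓ ht))).add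
    (id.mul ((id.mul (const 150)).add (const 100)))).add ((const 3).mul hS)).add (const 50)).add
    (id.mul ((id.mul (const 30)).add (const 15)))).add ((const 2).mul ((const w).add id))).add
    (const 40)

theorem mul_negligible (hf : PolyBounded f) {ε : ℕ → ℝ} (hε : Negligible ε) :
    Negligible fun n => (f n : ℝ) * ε n := by
  obtain ⟨p, hp⟩ := hf
  have h := hε.polynomial_mul (p.map (Nat.castRingHom ℝ))
  refine h.trans_abs_le fun n => ?_
  rw [abs_mul, abs_mul, Polynomial.eval_natCast_map]
  refine mul_le_mul_of_nonneg_right ?_ (abs_nonneg _)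
  rw [Nat.abs_cast]
  refine le_trans ?_ (le_abs_self _)
  exact Nat.cast_le.2 (hp n)

end PolyBounded

theorem InstructionSet.exists_unitsOfSize (I : InstructionSet w) :
    ∃ S, PolyBounded S ∧ ∀ n, UnitsOfSize I n (S n) := by
  classical
  -- Tags embed the operations into the words of fixed length `w`. There are thus finitely many, and
  -- the sum of their circuit sizes is still polynomial in `n`.
  have hO : Finite I.Op := Finite.of_injective (fun θ => I.tag (.opConst θ 0)) fun a b h => by
    simpa using I.tag_injective h
  have hR : Finite I.Rel := Finite.of_injective (fun R => I.tag (.relConst R 0)) fun a b h => by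
    simpa using I.tag_injective h
  have := Fintype.ofFinite I.Op
  have := Fintype.ofFinite I.Rel
  choose C hC hC' using I.eval_poly
  choose C₂ hC₂ hC₂' using I.test_poly
  refine ⟨fun n => (∑ θ, (C θ n).size) + ∑ R, (C₂ R n).size,
    (PolyBounded.sum _ fun θ _ => hC θ).add (PolyBounded.sum _ fun R _ => hC₂ R), fun n =>
    ⟨fun θ => ⟨C θ n, ?_, hC' θ n⟩, fun R => ⟨C₂ R n, ?_, hC₂' R n⟩⟩⟩
  · exact (Finset.single_le_sum (f := fun θ => (C θ n).size) (fun _ _ => Nat.zero_le _)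
      (Finset.mem_univ θ)).trans (Nat.le_add_right _ _)
  · exact (Finset.single_le_sum (f := fun R => (C₂ R n).size) (fun _ _ => Nat.zero_le _)
      (Finset.mem_univ R)).trans (Nat.le_add_left _ _)

/-! ### Reductions -/

theorem length_le_sum_cost {κ : Type} (gs : List (Gate κ)) :
    gs.length ≤ (gs.map Gate.cost).sum := by
  induction gs with
  | nil => simp
  | cons g gs ih =>
    have : 1 ≤ g.cost := by cases g <;> simp [Gate.cost]
    simp only [List.length_cons, List.map_cons, List.sum_cons]
    omega

theorem sum_cost_gameGates (I : InstructionSet w) {n : ℕ} (ms : List (BitVec w × BitVec n))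
    (gs : List (Gate (I.Op ⊕ I.Rel))) :
    ((gameGates I ms gs).map Gate.cost).sum = ms.length + (gs.map Gate.cost).sum := by
  rw [gameGates, List.map_append, List.sum_append, encryptGates, List.map_map, List.map_map]
  congr 1
  · induction ms with
    | nil => rfl
    | cons m ms ih =>
      rw [List.map_cons, List.sum_cons, ih, List.length_cons, add_comm]
      rfl
  · exact congrArg List.sum (List.map_congr_left fun g _ => Gate.cost_relabel _ g)

/-- One circuit works for every encryption function, selection and state. The same construction
therefore gives the IND-CPA distinguisher, for both values of the hidden bit, and the INT-CTXT
forger. -/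
theorem exists_reduction {I : InstructionSet w} {n ℓ S t F M : ℕ} (hI : UnitsOfSize I n S)
    (δ : BitVec n) {fin : List Bool → List (BitVec ℓ × BitVec w × BitVec n) → List Bool}
    (hfin : FinalComputes w ℓ n t F fin) (hM : ∀ v T, (fin v T).length ≤ M)
    (ms : List (BitVec w × BitVec n)) (gs : List (Gate (I.Op ⊕ I.Rel)))
    (ht : ms.length + (gs.map Gate.cost).sum ≤ t) :
    ∃ R : OracleCircuit Unit, R.size ≤ simFactor w ℓ n t S * t + F + M ∧
      ∀ {σ : Type} (enc : BitVec w × BitVec n → PMF (BitVec ℓ))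
        (sel : BitVec w × BitVec n → BitVec w × BitVec n → BitVec w × BitVec n)
        (upd : σ → BitVec ℓ → σ) (s : σ), R.run (selOracle enc sel upd) [] s =
        (runGates (tableOracle I (fun m => enc (sel m (shift δ m))) upd) (gameGates I ms gs) []
          ([], s)).map fun r => (fin r.1 r.2.1, r.2.2) := by
  have h := length_le_sum_cost (gameGates I ms gs)
  rw [sum_cost_gameGates] at h
  obtain ⟨gs', out, h1, h2, h3⟩ := exists_simulates (δ := δ) hI hfin hM (gameGates I ms gs) 0 [] []
    0 (by simp) (by simp) (by simp) (by omega)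
  refine ⟨⟨gs', out⟩, ?_, fun {σ} enc sel upd s => h3 enc sel upd [] [] s rfl rfl rfl⟩
  rw [sum_cost_gameGates] at h1
  have := Nat.mul_le_mul_left (simFactor w ℓ n t S) ht
  rw [OracleCircuit.size]
  simp only
  omega

/-! ### Restricted operators and IND-CPA. -/

namespace Operator

variable {I : InstructionSet w} (A : Operator I) (E : Encryption w)

/-- The plaintexts of the items in view. -/
def items (n : ℕ) (D : (A.prog n).Scheme) : List (BitVec w × BitVec n) :=
  (A.view n).flatMap ((A.prog n).itemPlains D (A.input n))

/-- A bound for the number of ciphertexts in the game. -/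
def tableBound (n : ℕ) : ℕ := 3 * (A.view n).length + (A.circuit n).size

variable {A}

theorem PolyTime.tableBound (hA : A.PolyTime) : PolyBounded A.tableBound :=
  ((PolyBounded.const 3).mul hA.1).add hA.2

theorem length_items (n : ℕ) (D : (A.prog n).Scheme) :
    (A.items n D).length ≤ 3 * (A.view n).length := by
  rw [items, List.length_flatMap, mul_comm]
  refine (List.sum_le_card_nsmul _ 3 ?_).trans (by simp)
  simp only [List.mem_map, forall_exists_index, and_imp, forall_apply_eq_imp_iff₂]
  exact fun x _ => Program.length_itemPlains _ _ x

theorem length_items_add_le (n : ℕ) (D : (A.prog n).Scheme) :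
    (A.items n D).length + ((A.circuit n).gates.map Gate.cost).sum ≤ A.tableBound n := by
  have := length_items n D
  rw [Operator.tableBound, OracleCircuit.size]
  omega

theorem items_shift (n : ℕ) (D : (A.prog n).Scheme) (δ : BitVec n) :
    A.items n ((A.prog n).shiftScheme D δ) = (A.items n D).map (shift δ) := by
  rw [items, items, List.map_flatMap]
  exact congrArg (fun f => List.flatMap f (A.view n))
    (funext fun x => Program.itemPlains_shift D _ δ x)

variable (A)

/-- The game for a given key and obfuscation scheme. -/
noncomputable def gameWith (μ : Interference) (n : ℕ) (k : E.Key n) (D : (A.prog n).Scheme) :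
    PMF (A.Outcome E n) :=
  (encryptAll E n k (A.items n D)).bind fun cs =>
    ((A.circuit n).run (platform E I n k μ) (cs.flatMap wordBits) cs).map fun r =>
      ⟨k, D, r.1, r.2⟩

theorem game_eq (μ : Interference) (n : ℕ) : A.game E μ n =
    (E.gen n).bind fun k => (A.prog n).randomScheme.bind fun D => A.gameWith E μ n k D.1 := rfl

variable {A E}

theorem gameWith_observed {n : ℕ} {k : E.Key n} (hk : k ∈ (E.gen n).support)
    (D : (A.prog n).Scheme) (δ : BitVec n) {σ : Type} (upd : σ → BitVec (E.ctLen n) → σ) (s : σ) :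
    A.gameWith E .observed n k ((A.prog n).shiftScheme D δ) =
      (runGates (tableOracle I (fun m => E.enc n k (shift δ m)) upd)
        (gameGates I (A.items n D) (A.circuit n).gates) [] ([], s)).map fun r =>
          ⟨k, (A.prog n).shiftScheme D δ, (A.circuit n).out.map (wire r.1),
            r.2.1.map Prod.fst⟩ := by
  have h := congrArg (PMF.map fun r : List Bool × List (BitVec (E.ctLen n)) =>
    (⟨k, (A.prog n).shiftScheme D δ, r.1, r.2⟩ : A.Outcome E n))
    (run_observed (δ := δ) I hk upd s (A.items n D) (A.circuit n))
  rw [PMF.map_bind, PMF.map_comp, ← items_shift] at h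
  exact h

/-- A restricted operator gains only negligibly over its success with encryptions that are
independent of the offset `δ`. -/
theorem exists_negligible_observed (hE : E.INDCPA) (hA : A.PolyTime)
    {S : ∀ n, Set (A.Outcome E n)}
    {succ : ∀ n, (A.prog n).Scheme → BitVec n → List Bool →
      List (BitVec (E.ctLen n) × BitVec w × BitVec n) → Bool}
    {c : ℕ → ℝ} (hc : ∀ n, 0 ≤ c n) {F : ℕ → ℕ} (hF : PolyBounded F)
    (h1 : ∀ n k D, (A.prog n).Consistent D → ∀ δ T out, E.Decrypts k δ T →
      (⟨k, (A.prog n).shiftScheme D δ, out, T.map Prod.fst⟩ : A.Outcome E n) ∈ S n →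
        succ n D δ out T = true)
    (h2 : ∀ n D out T, (PMF.uniformOfFintype (BitVec n)).toOuterMeasure
      {δ | succ n D δ out T = true} ≤ ENNReal.ofReal (c n))
    (h3 : ∀ n D δ, FinalComputes w (E.ctLen n) n (A.tableBound n) (F n) fun vs T =>
      [succ n D δ ((A.circuit n).out.map (wire vs)) T]) :
    ∃ ε : ℕ → ℝ, Negligible ε ∧ ∀ n, prob (A.game E .observed n) (S n) ≤ c n + ε n := by
  obtain ⟨B, hB, hI⟩ := I.exists_unitsOfSize
  choose R hR hrun using fun n D δ => exists_reduction (hI n) δ (h3 n D δ) (M := 1)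
    (fun _ _ => le_rfl) (A.items n D) (A.circuit n).gates (length_items_add_le n D)
  -- For each `n` there are finitely many schemes and offsets. The pair with the largest advantage
  -- is hardwired, so a single circuit family bounds the advantage for all pairs.
  have hmax : ∀ n, ∃ x : {D : (A.prog n).Scheme // (A.prog n).Consistent D} × BitVec n,
      ∀ y : {D : (A.prog n).Scheme // (A.prog n).Consistent D} × BitVec n,
      |E.acceptProb n (R n y.1.1 y.2) true - E.acceptProb n (R n y.1.1 y.2) false| ≤
        |E.acceptProb n (R n x.1.1 x.2) true - E.acceptProb n (R n x.1.1 x.2) false| := fun n => by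
    classical
    exact Finite.exists_max _
  choose x hx using hmax
  refine ⟨_, hE (fun n => R n (x n).1.1 (x n).2) ?_, fun n => ?_⟩
  · exact ((((PolyBounded.simFactor E.ctLen_poly hA.tableBound hB).mul hA.tableBound).add
      hF).add (.const 1)).mono fun n => hR n _ _
  set ε := |E.acceptProb n (R n (x n).1.1 (x n).2) true -
    E.acceptProb n (R n (x n).1.1 (x n).2) false| with hε
  have hε0 : 0 ≤ ε := abs_nonneg _
  refine prob_le (add_nonneg (hc n) hε0) ?_
  rw [ENNReal.ofReal_add (hc n) hε0]
  -- `W true` is the real game for the scheme shifted by `δ`; in `W false` the encryptions ignore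
  -- `δ`.
  let W : Bool → (A.prog n).Scheme → BitVec n → E.Key n → PMF (List Bool × _ × Unit) :=
    fun b D δ k => runGates (tableOracle I
      (fun m => E.enc n k (if b then shift δ m else m)) fun _ _ => ())
      (gameGates I (A.items n D) (A.circuit n).gates) [] ([], ())
  let V : Bool → (A.prog n).Scheme → BitVec n → E.Key n → PMF Bool := fun b D δ k =>
    (W b D δ k).map fun r => succ n D δ ((A.circuit n).out.map (wire r.1)) r.2.1
  have hacc : ∀ b D δ, ENNReal.ofReal (E.acceptProb n (R n D δ) b) =
      ((E.gen n).bind (V b D δ)).toOuterMeasure {true} := by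
    intro b D δ
    rw [Encryption.acceptProb, ofReal_prob]
    have e : ∀ k, (R n D δ).run (E.leftRight n k b) [] () = (W b D δ k).map fun r =>
        ([succ n D δ ((A.circuit n).out.map (wire r.1)) r.2.1], r.2.2) := fun k =>
      hrun n D δ (E.enc n k) (fun l r => if b then r else l) (fun _ _ => ()) ()
    simp only [e]
    refine le_antisymm ?_ ?_ <;>
    exact PMF.toOuterMeasure_bind_mono fun k _ => PMF.toOuterMeasure_map_mono fun r _ hr => by
      simpa using hr
  have hgame : A.game E .observed n = (PMF.uniformOfFintype (BitVec n)).bind fun δ =>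
      (A.prog n).randomScheme.bind fun D => (E.gen n).bind fun k =>
        A.gameWith E .observed n k ((A.prog n).shiftScheme D.1 δ) := by
    rw [game_eq]
    refine (congrArg _ (funext fun k =>
      Program.randomScheme_bind_shift fun D => A.gameWith E .observed n k D)).trans ?_
    rw [PMF.bind_comm]
    refine congrArg _ (funext fun δ => ?_)
    rw [PMF.bind_comm]
  rw [hgame]
  have step1 : ∀ δ (D : {D : (A.prog n).Scheme // (A.prog n).Consistent D}),
      ((E.gen n).bind fun k => A.gameWith E .observed n k
        ((A.prog n).shiftScheme D.1 δ)).toOuterMeasure (S n) ≤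
      ((E.gen n).bind (V false D.1 δ)).toOuterMeasure {true} + ENNReal.ofReal ε := by
    intro δ D
    rw [← hacc, ← ENNReal.ofReal_add (show 0 ≤ E.acceptProb n (R n D.1 δ) false from prob_nonneg _ _) hε0]
    refine le_trans ?_ (ENNReal.ofReal_le_ofReal (p := E.acceptProb n (R n D.1 δ) true) ?_)
    · rw [hacc]
      refine PMF.toOuterMeasure_bind_mono fun k hk => ?_
      rw [gameWith_observed hk D.1 δ (fun _ _ => ()) ()]
      refine PMF.toOuterMeasure_map_mono fun r hr hS => ?_
      refine h1 n k D.1 D.2 δ _ _ ?_ hS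
      exact runGates_invariant (Inv := fun t => E.Decrypts k δ t.1)
        (decrypts_tableOracle I hk _) _ _ ([], ()) (by simp [Encryption.Decrypts]) r hr
    · have := (le_abs_self _).trans (hx n (D, δ))
      linarith
  refine (PMF.toOuterMeasure_bind_le_add fun δ _ =>
    PMF.toOuterMeasure_bind_le_add fun D _ => step1 δ D).trans ?_
  gcongr
  rw [PMF.bind_comm]
  refine PMF.toOuterMeasure_bind_le fun D _ => ?_
  rw [PMF.bind_comm]
  refine PMF.toOuterMeasure_bind_le fun k _ => ?_
  -- Since `W false` does not depend on `δ`, the value `0` can stand in for it, and `δ` is drawn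
  -- after the transcript `r` is complete.
  have e : ((PMF.uniformOfFintype (BitVec n)).bind fun δ => V false D.1 δ k) =
      (W false D.1 0 k).bind fun r => (PMF.uniformOfFintype (BitVec n)).map fun δ =>
        succ n D.1 δ ((A.circuit n).out.map (wire r.1)) r.2.1 := by
    simp only [V, PMF.map, Function.comp_def]
    rw [PMF.bind_comm]
    rfl
  rw [e]
  refine PMF.toOuterMeasure_bind_le fun r _ => ?_
  rw [PMF.toOuterMeasure_map_apply]
  exact h2 n D.1 _ _

end Operator

/-! ### Forgeries -/

section Forged

variable (E : Encryption w) (I : InstructionSet w) {n : ℕ} (k : E.Key n)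

/-- The ciphertext `c` is valid but not among those issued. -/
def Encryption.Forged (issued : List (BitVec (E.ctLen n))) (c : BitVec (E.ctLen n)) : Prop :=
  c ∉ issued ∧ (E.dec n k c).isSome

variable {E k}

theorem contentOf_arbitrary {issued : List (BitVec (E.ctLen n))} {c : BitVec (E.ctLen n)}
    (h : ¬ E.Forged k issued c) (κ : WordKind I.Op I.Rel) :
    contentOf E I n k .arbitrary issued κ c = contentOf E I n k .observed issued κ c := by
  rw [contentOf, contentOf, plainOf, plainOf]
  split_ifs with hc
  · rfl
  · have : E.dec n k c = none := by
      by_contra h0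
      exact h ⟨hc, Option.isSome_iff_ne_none.2 h0⟩
    rw [this]

/-- Some word of the query is forged. -/
def BadQuery (E : Encryption w) (k : E.Key n) (q : List Bool)
    (issued : List (BitVec (E.ctLen n))) : Prop :=
  ∃ j < 5, E.Forged k issued (readWord (E.ctLen n) (j * E.ctLen n) q)

/-- Five positions cover an arithmetic instruction. A test reads only four words; inspecting a fifth
merely enlarges the bad event. -/
theorem platform_arbitrary (κ : I.Op ⊕ I.Rel) (q : List Bool)
    (issued : List (BitVec (E.ctLen n))) (h : ¬ BadQuery E k q issued) :
    platform E I n k .arbitrary κ q issued = platform E I n k .observed κ q issued := by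
  have h' : ∀ j < 5, ∀ κ, contentOf E I n k .arbitrary issued κ
      (readWord (E.ctLen n) (j * E.ctLen n) q) = contentOf E I n k .observed issued κ
      (readWord (E.ctLen n) (j * E.ctLen n) q) := fun j hj =>
    contentOf_arbitrary I fun hf => h ⟨j, hj, hf⟩
  rcases κ with θ | R
  · simp only [platform, h' 0 (by norm_num), h' 1 (by norm_num), h' 2 (by norm_num),
      h' 3 (by norm_num), h' 4 (by norm_num)]
  · simp only [platform, h' 0 (by norm_num), h' 1 (by norm_num), h' 2 (by norm_num),
      h' 3 (by norm_num)]

end Forged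

/-! ### Unrestricted operators and INT-CTXT. -/

namespace Operator

open scoped ENNReal

variable {I : InstructionSet w} (A : Operator I) (E : Encryption w)

/-- A restricted run of a circuit on the items in view, together with the key. -/
noncomputable def restrictedRun (n : ℕ) (C : OracleCircuit (I.Op ⊕ I.Rel)) (k : E.Key n)
    (D : (A.prog n).Scheme) : PMF (E.Key n × List Bool × List (BitVec (E.ctLen n))) :=
  (encryptAll E n k (A.items n D)).bind fun cs =>
    (C.run (platform E I n k .observed) (cs.flatMap wordBits) cs).map fun r => (k, r)

/-- The event that the output starts with a forged ciphertext. -/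
def forgery (n : ℕ) : Set (E.Key n × List Bool × List (BitVec (E.ctLen n))) :=
  {r | E.Forged r.1 r.2.2 (readWord (E.ctLen n) 0 r.2.1)}

/-- The circuit of the operator, stopped at gate `i` with the word at position `j` of the query as
output. -/
def queryCircuit (n i j : ℕ) : OracleCircuit (I.Op ⊕ I.Rel) where
  gates := (A.circuit n).gates.take i
  out := match (A.circuit n).gates[i]? with
    | some (.ask _ q) => (q.drop (j * E.ctLen n)).take (E.ctLen n)
    | _ => (A.circuit n).out

variable {A E}

theorem finalComputes_output {ℓ n t : ℕ} (L : List ℕ) : FinalComputes w ℓ n t (L.length * 2)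
    fun vs _ => L.map (wire vs) := by
  intro a b _
  exact ((Computes.left (fun x => x.2.1) fun x =>
    flatMap_length_const _ x.2.2).trans (Computes.wires (fun x => x.2.1) L)).mono (by omega)

/-- With `δ = 0` and the selection of the first plaintext, the oracle of the simulation is the plain
encryption oracle. The table and the oracle's record may list the issued ciphertexts in different
orders, but have the same members, which is all that a forgery depends on. -/
theorem exists_forger {S : ℕ} {n : ℕ} (hI : UnitsOfSize I n S)
    (C : OracleCircuit (I.Op ⊕ I.Rel)) (D : (A.prog n).Scheme) {t : ℕ}
    (ht : (A.items n D).length + (C.gates.map Gate.cost).sum ≤ t) :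
    ∃ R : OracleCircuit Unit,
      R.size ≤ simFactor w (E.ctLen n) n t S * t + C.out.length * 2 + C.out.length ∧
      ((E.gen n).bind fun k => A.restrictedRun E n C k D).toOuterMeasure (forgery E n) ≤
        ENNReal.ofReal (E.forgeProb n R) := by
  obtain ⟨R, hR, hrun⟩ := exists_reduction (ℓ := E.ctLen n) hI (0 : BitVec n)
    (finalComputes_output C.out) (fun _ _ => (List.length_map _).le) (A.items n D) C.gates ht
  refine ⟨R, hR, ?_⟩
  rw [Encryption.forgeProb, ofReal_prob]
  refine PMF.toOuterMeasure_bind_mono fun k hk => ?_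
  have e0 : ∀ m : BitVec w × BitVec n, shift 0 m = m := fun m => by simp [shift]
  have e1 := run_observed (δ := 0) I hk (fun s c => c :: s) [] (A.items n D) C
  have e2 : R.run (E.encOracle n k) [] [] = _ :=
    hrun (E.enc n k) (fun l _ => l) (fun s c => c :: s) []
  simp only [e0] at e1
  rw [List.map_id''] at e1
  · have e3 := congrArg (PMF.map fun r => (k, r)) e1
    rw [PMF.map_bind, PMF.map_comp] at e3
    rw [restrictedRun, e3, e2, PMF.map_comp]
    refine PMF.toOuterMeasure_map_mono fun r hr h => ?_
    have hinv := runGates_invariant (O := tableOracle I (E.enc n k) fun s c => c :: s)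
      (Inv := fun t : List (BitVec (E.ctLen n) × BitVec w × BitVec n) × List (BitVec (E.ctLen n)) =>
        ∀ c, c ∈ t.2 ↔ c ∈ t.1.map Prod.fst)
      (fun κ q t ht => issued_tableOracle I (E.enc n k) κ q t ht) _ _ ([], []) (by simp) r hr
    exact ⟨fun hm => h.1 ((hinv _).1 hm), h.2⟩
  · exact e0

theorem queryCircuit_sum_le (n i j : ℕ) (D : (A.prog n).Scheme) :
    (A.items n D).length + ((A.queryCircuit E n i j).gates.map Gate.cost).sum ≤
      A.tableBound n := by
  refine le_trans ?_ (length_items_add_le n D)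
  refine Nat.add_le_add_left ?_ _
  exact ((List.take_sublist _ _).map _).sum_le_sum fun _ _ => Nat.zero_le _

theorem queryCircuit_out_le (n i j : ℕ) :
    (A.queryCircuit E n i j).out.length ≤ (A.circuit n).size := by
  rw [queryCircuit, OracleCircuit.size]
  simp only
  split
  · rename_i k q h
    have h1 : Gate.cost (.ask k q : Gate (I.Op ⊕ I.Rel)) ≤
        ((A.circuit n).gates.map Gate.cost).sum :=
      List.single_le_sum (fun _ _ => Nat.zero_le _) _
        (List.mem_map_of_mem (List.mem_of_getElem? h))
    rw [Gate.cost] at h1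
    rw [List.length_take, List.length_drop]
    omega
  · omega

/-- A single forger family suffices, since the best scheme, gate and position can be hardwired for
each `n`. The index equal to the number of gates is included to cover forgeries in the final output.
-/
theorem exists_negligible_forgery (hE : E.INTCTXT) (hA : A.PolyTime) :
    ∃ ε : ℕ → ℝ, Negligible ε ∧ (∀ n, 0 ≤ ε n) ∧ ∀ n, ∀ i ≤ (A.circuit n).gates.length, ∀ j < 5,
      ((E.gen n).bind fun k => (A.prog n).randomScheme.bind fun D =>
        A.restrictedRun E n (A.queryCircuit E n i j) k D.1).toOuterMeasure (forgery E n) ≤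
          ENNReal.ofReal (ε n) := by
  obtain ⟨B, hB, hI⟩ := I.exists_unitsOfSize
  choose R hR hforge using fun n D i j => exists_forger (E := E) (hI n) (A.queryCircuit E n i j) D
    (queryCircuit_sum_le n i j D)
  have hmax : ∀ n, ∃ x : {D : (A.prog n).Scheme // (A.prog n).Consistent D} ×
      Fin ((A.circuit n).gates.length + 1) × Fin 5,
      ∀ y : {D : (A.prog n).Scheme // (A.prog n).Consistent D} ×
        Fin ((A.circuit n).gates.length + 1) × Fin 5,
      E.forgeProb n (R n y.1.1 y.2.1 y.2.2) ≤ E.forgeProb n (R n x.1.1 x.2.1 x.2.2) := fun n => by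
    classical
    exact Finite.exists_max _
  choose x hx using hmax
  refine ⟨_, hE (fun n => R n (x n).1.1 (x n).2.1 (x n).2.2) ?_, fun n => prob_nonneg _ _, ?_⟩
  · refine ((((PolyBounded.simFactor (w := w) E.ctLen_poly hA.tableBound hB).mul
      hA.tableBound).add
      (hA.2.mul (.const 2))).add hA.2).mono fun n => (hR n _ _ _).trans ?_
    have := queryCircuit_out_le (A := A) (E := E) n (x n).2.1 (x n).2.2
    omega
  · intro n i hi j hj
    rw [PMF.bind_comm]
    refine PMF.toOuterMeasure_bind_le fun D _ => (hforge n D.1 i j).trans ?_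
    exact ENNReal.ofReal_le_ofReal (hx n (D, ⟨i, Nat.lt_succ_of_le hi⟩, ⟨j, hj⟩))

theorem gameWith_arbitrary_le {n : ℕ} (k : E.Key n) (D : (A.prog n).Scheme)
    (S : Set (A.Outcome E n)) :
    (A.gameWith E .arbitrary n k D).toOuterMeasure S ≤
      (A.gameWith E .observed n k D).toOuterMeasure S +
        ∑ x ∈ Finset.range (A.circuit n).gates.length ×ˢ Finset.range 5,
          (A.restrictedRun E n (A.queryCircuit E n x.1 x.2) k D).toOuterMeasure
            (forgery E n) := by
  refine PMF.toOuterMeasure_bind_le_add_sum fun cs _ => ?_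
  rw [OracleCircuit.run, OracleCircuit.run, PMF.map_comp, PMF.map_comp,
    PMF.toOuterMeasure_map_apply, PMF.toOuterMeasure_map_apply]
  refine (runGates_until_bad (Bad := fun _ => BadQuery E k)
    (fun κ q s h => platform_arbitrary I κ q s h) _ _ _ _).trans ?_
  gcongr
  rw [Finset.sum_product]
  refine Finset.sum_le_sum fun i _ => ?_
  have hsub : badAt (fun _ : I.Op ⊕ I.Rel => BadQuery E k) (A.circuit n).gates i ⊆
      ⋃ j ∈ Finset.range 5, {r | E.Forged k r.2 (readWord (E.ctLen n) 0
        ((A.queryCircuit E n i j).out.map (wire r.1)))} := by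
    rintro r ⟨κ, q, hq, j, hj, hf⟩
    refine Set.mem_iUnion₂.2 ⟨j, Finset.mem_range.2 hj, ?_⟩
    have e : readWord (E.ctLen n) 0 ((A.queryCircuit E n i j).out.map (wire r.1)) =
        readWord (E.ctLen n) (j * E.ctLen n) (q.map (wire r.1)) := by
      -- A query may be too short for position `j`; missing bits read `false` on both sides.
      apply BitVec.eq_of_getLsbD_eq
      intro m hm
      rw [getLsbD_readWord _ _ hm, getLsbD_readWord _ _ hm]
      simp only [queryCircuit, hq, wire, zero_add, List.getD_eq_getElem?_getD, List.getElem?_map,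
        List.getElem?_take, List.getElem?_drop, hm, if_true]
    rw [Set.mem_ofPred_eq, e]
    exact hf
  refine (MeasureTheory.measure_mono hsub).trans
    ((MeasureTheory.measure_biUnion_finset_le _ _).trans (Finset.sum_le_sum fun j _ => ?_))
  rw [OracleCircuit.run, PMF.map_comp, PMF.toOuterMeasure_map_apply]
  exact le_rfl

/-- An unrestricted operator gains only negligibly over a restricted one, and a restricted one
forges only with negligible probability. -/
theorem exists_negligible_arbitrary (hE : E.INTCTXT) (hA : A.PolyTime) :
    ∃ ε : ℕ → ℝ, Negligible ε ∧ (∀ n, 0 ≤ ε n) ∧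
      (∀ n (S : Set (A.Outcome E n)),
        prob (A.game E .arbitrary n) S ≤ prob (A.game E .observed n) S + ε n) ∧
      ∀ n, prob (A.game E .observed n)
        {o | E.Forged o.key o.issued (readWord (E.ctLen n) 0 o.output)} ≤ ε n := by
  obtain ⟨ε, h1, h2, h3⟩ := exists_negligible_forgery hE hA
  -- Five possible forgeries per gate; the extra `1` ensures a factor of at least one, which the
  -- bound on forged final outputs needs.
  refine ⟨fun n => ((A.circuit n).size * 5 + 1 : ℕ) * ε n,
    ((hA.2.mul (.const 5)).add (.const 1)).mul_negligible h1,
    fun n => mul_nonneg (Nat.cast_nonneg _) (h2 n), fun n S => ?_, fun n => ?_⟩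
  · refine prob_le (add_nonneg (prob_nonneg _ _) (mul_nonneg (Nat.cast_nonneg _) (h2 n))) ?_
    rw [ENNReal.ofReal_add (prob_nonneg _ _) (mul_nonneg (Nat.cast_nonneg _) (h2 n)), ofReal_prob,
      game_eq, game_eq]
    refine (PMF.toOuterMeasure_bind_le_add_sum fun k _ =>
      PMF.toOuterMeasure_bind_le_add_sum fun D _ => gameWith_arbitrary_le k D.1 S).trans ?_
    gcongr
    refine (Finset.sum_le_card_nsmul _ _ (ENNReal.ofReal (ε n)) fun x hx => ?_).trans ?_
    · rw [Finset.mem_product, Finset.mem_range, Finset.mem_range] at hx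
      exact h3 n x.1 hx.1.le x.2 hx.2
    · rw [Finset.card_product, Finset.card_range, Finset.card_range,
        ENNReal.ofReal_mul (Nat.cast_nonneg _), ENNReal.ofReal_natCast, nsmul_eq_mul]
      refine mul_le_mul_left ?_ _
      have := length_le_sum_cost (A.circuit n).gates
      have h : (A.circuit n).gates.length * 5 ≤ (A.circuit n).size * 5 + 1 := by
        rw [OracleCircuit.size]
        omega
      exact_mod_cast h
  · refine prob_le (mul_nonneg (Nat.cast_nonneg _) (h2 n)) ?_
    have h := h3 n _ le_rfl 0 (by norm_num)
    -- There is no gate at this index, so `queryCircuit` falls back on the operator's own output.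
    have e : A.queryCircuit E n (A.circuit n).gates.length 0 = A.circuit n := by
      simp [queryCircuit]
    rw [e] at h
    refine le_trans ?_ (h.trans (ENNReal.ofReal_le_ofReal ?_))
    · rw [game_eq]
      refine PMF.toOuterMeasure_bind_mono fun k _ => PMF.toOuterMeasure_bind_mono fun D _ =>
        PMF.toOuterMeasure_bind_mono fun cs _ => PMF.toOuterMeasure_map_mono fun r _ hr => hr
    · refine le_mul_of_one_le_left (h2 n) ?_
      exact_mod_cast Nat.le_add_left 1 _

/-! ### The two attacks -/

theorem exists_negligible_discovers (hE : E.INDCPA) (hA : A.PolyTime) (t : ℕ → ℕ)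
    (r : ∀ n, Fin (A.prog n).locs) (φ : ∀ n, BitVec n → List Bool) :
    ∃ ε : ℕ → ℝ, Negligible ε ∧
      ∀ n, prob (A.game E .observed n) (A.discovers E (t n) (r n) (φ n)) ≤
        chance (φ n) + ε n := by
  refine exists_negligible_observed hE hA
    (succ := fun n D δ out _ => decide
      (out = φ n (((A.prog n).compiledRun D (A.input n) (t n)).store (r n) + δ)))
    (fun n => chance_nonneg _) (F := fun n => (A.circuit n).size * 16 + 4)
    ((hA.2.mul (.const 16)).add (.const 4)) ?_ ?_ ?_
  · intro n k D hD δ T out _ h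
    rw [discovers, Set.mem_ofPred_eq, Program.compiledRun_shift hD] at h
    exact decide_eq_true h
  · intro n D out T
    simp only [decide_eq_true_eq]
    exact uniform_attribute_le _ _ _
  · intro n D δ a b hb
    have hC := finalComputes_output (w := w) (ℓ := E.ctLen n) (n := n) (t := A.tableBound n)
      (A.circuit n).out a b hb
    have hs : (A.circuit n).out.length ≤ (A.circuit n).size := Nat.le_add_left _ _
    -- The attribute `φ n` need not be computable: with `D` and `δ` fixed, its value is a constant
    -- to be hardwired. If its length differs from that of the output, the answer is constantly
    -- `false`.
    generalize φ n _ = l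
    by_cases hl : l.length = (A.circuit n).out.length
    · exact (hC.listEq (.const hC.1 l) (fun _ => List.length_map _) fun _ => hl).mono (by omega)
    · refine ((Computes.const hC.1 [false]).mono (by omega)).congr fun x => ?_
      refine congrArg (fun b => [b]) (decide_eq_false ?_).symm
      rintro rfl
      exact hl (List.length_map _)

theorem exists_negligible_alters (hE : E.INDCPA) (hA : A.PolyTime) :
    ∃ ε : ℕ → ℝ, Negligible ε ∧
      ∀ n, prob (A.game E .observed n) (A.alters E .observed) ≤ 1 / 2 ^ n + ε n := by
  refine exists_negligible_observed hE hA
    (succ := fun n _ δ out T => decide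
      (((lookup (I.tag .data) (readWord (E.ctLen n) 0 out) T).map fun x => x + δ) =
        some (readWord n (E.ctLen n) out)))
    (fun n => by positivity)
    (F := fun n => 2 * ((A.circuit n).size * 2 + E.ctLen n * 2 +
      lookupCost w (E.ctLen n) n (A.tableBound n)) + n * (n * 30 + 14) +
        (A.circuit n).size * 2 + n * 16 + 10)
    ((((((PolyBounded.const 2).mul (((hA.2.mul (.const 2)).add
      (E.ctLen_poly.mul (.const 2))).add (.lookupCost E.ctLen_poly hA.tableBound))).add
        (PolyBounded.id.mul ((PolyBounded.id.mul (.const 30)).add (.const 14)))).add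
          (hA.2.mul (.const 2))).add (PolyBounded.id.mul (.const 16))).add (.const 10)) ?_ ?_ ?_
  · intro n k D hD δ T out hT h
    rw [alters, Set.mem_ofPred_eq, contentOf_observed I hT] at h
    exact decide_eq_true h
  · intro n D out T
    simp only [decide_eq_true_eq]
    exact uniform_shift_le _ _
  · intro n D δ a b hb
    have hC := finalComputes_output (w := w) (ℓ := E.ctLen n) (n := n) (t := A.tableBound n)
      (A.circuit n).out a b hb
    have hs : (A.circuit n).out.length ≤ (A.circuit n).size := Nat.le_add_left _ _
    have hT := Computes.right (g := fun x : {x : List Bool ×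
      List (BitVec (E.ctLen n) × BitVec w × BitVec n) // x.1.length = a ∧ x.2.length = b} =>
        x.1.1) (h := fun x => x.1.2.flatMap entryBits) (fun x => x.2.1)
        fun x => flatMap_length_const _ x.2.2
    have hq := hC.trans (Computes.readWord (fun _ => List.length_map _) (E.ctLen n) 0)
    have ho := Computes.lookup (I.tag .data) hq hT fun x => x.2.2
    have hv := hC.trans (Computes.readWord (fun _ => List.length_map _) n (E.ctLen n))
    have hlc := Nat.mul_le_mul_right (E.ctLen n * 14 + w * 14 + n * 22 + 40) hb
    refine ((ho.isSome.and ((ho.value.add (.const hC.1 (wordBits δ))).wordEq hv)).congr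
      fun x => ?_).mono ?_
    · congr 1
      rw [Bool.eq_iff_iff]
      cases lookup (I.tag .data) (readWord (E.ctLen n) 0 ((A.circuit n).out.map (wire x.1.1)))
        x.1.2 <;> simp
    · simp only [lookupCost]
      omega

end Operator

theorem mainTheorem7 {w : ℕ} (E : Encryption w) (I : InstructionSet w) :
    (E.INDCPA → ResistsAttacks E I Interference.observed) ∧
      (E.INDCPA → E.INTCTXT → ResistsAttacks E I Interference.arbitrary) := by
  refine ⟨fun hE A hA => ⟨Operator.exists_negligible_discovers hE hA,
    Operator.exists_negligible_alters hE hA⟩, fun hE hE' A hA => ?_⟩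
  obtain ⟨ε, h1, h2, h3, h4⟩ := Operator.exists_negligible_arbitrary hE' hA
  refine ⟨fun t r φ => ?_, ?_⟩
  · obtain ⟨ε', h5, h6⟩ := Operator.exists_negligible_discovers hE hA t r φ
    refine ⟨ε' + ε, h5.add h1, fun n => (h3 n _).trans ?_⟩
    rw [Pi.add_apply, ← add_assoc]
    exact add_le_add_left (h6 n) _
  · obtain ⟨ε', h5, h6⟩ := Operator.exists_negligible_alters hE hA
    -- One `ε` for passing to the restricted game, the other for the possibility that the word put
    -- out is itself a forgery.
    refine ⟨ε' + (ε + ε), h5.add (h1.add h1), fun n => (h3 n _).trans ?_⟩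
    have h : prob (A.game E .observed n) (A.alters E .arbitrary) ≤
        prob (A.game E .observed n) (A.alters E .observed) + ε n := by
      refine prob_le (add_nonneg (prob_nonneg _ _) (h2 n)) ?_
      rw [ENNReal.ofReal_add (prob_nonneg _ _) (h2 n), ofReal_prob]
      have hsub : A.alters E .arbitrary ⊆ A.alters E .observed ∪
          {o : A.Outcome E n | E.Forged o.key o.issued (readWord (E.ctLen n) 0 o.output)} := by
        intro o ho
        by_cases hf : E.Forged o.key o.issued (readWord (E.ctLen n) 0 o.output)
        · exact Or.inr hf
        · refine Or.inl ?_
          rw [Operator.alters, Set.mem_ofPred_eq] at ho ⊢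
          rwa [← contentOf_arbitrary I hf]
      refine (MeasureTheory.measure_mono hsub).trans
        ((MeasureTheory.measure_union_le _ _).trans ?_)
      gcongr
      rw [← ofReal_prob]
      exact ENNReal.ofReal_le_ofReal (h4 n)
    have := h6 n
    simp only [Pi.add_apply]
    linarith
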